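/- There are absolute constants $C>0$ and $c\in\mathbb N$ such that the following holds for all $d,q,k\in\mathbb N$, all real $\varepsilon\in(0,1)$ and all real $s\ge 1$. Let $\mathcal F$ be the class of degree-$q$ polynomial threshold functions on $\mathbb R^d$ with intrinsic dimension $k$, that is, of all functions $f:\mathbb R^d\to\{-1,1\}$ such that $f(\mathbf x)=\operatorname{sign}(p(\mathbf x))$ for some real polynomial $p$ of total degree at most $q$ (with $\operatorname{sign}(0)=1$), and $f(\mathbf x)=F(\mathbf W\mathbf x)$ for all $\mathbf x$, for some $F:\mathbb R^k\to\{-1,1\}$ and some $\mathbf W\in\mathbb R^{k\times d}$ with $\mathbf W\mathbf W^\top=\mathbf I_{k\times k}$. The $(\varepsilon,s)$-sandwiching degree of a function $f$ with respect to $\mathcal D=\mathcal N(0,\mathbf I_{d\times d})$ is the least $\ell\in\mathbb N$ (or $\infty$ if there is none) for which there are polynomials $p_{\mathrm{up}},p_{\mathrm{down}}$ of degree at most $\ell$ with $p_{\mathrm{down}}(\mathbf x)\le f(\mathbf x)\le p_{\mathrm{up}}(\mathbf x)$ for all $\mathbf x\in\mathbb R^d$ and $\bigl(\mathbb E_{\mathbf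 x\sim\mathcal D}|p_{\mathrm{up}}(\mathbf x)-p_{\mathrm{down}}(\mathbf x)|^s\bigr)^{1/s}\le\varepsilon$; the sandwiching degree of a class is the supremum over its elements. Then the $(\varepsilon,s)$-sandwiching degree $\ell(\varepsilon,s)$ of $\mathcal F$ with respect to $\mathcal N(0,\mathbf I_{d\times d})$ satisfies $$\ell(\varepsilon,s)\;\le\;\bigl(C\,X\,\log^{c}(X+2)\bigr)^{2},\qquad X=\frac{q^3k^{5/2}s}{(\varepsilon/2)^{s+1}},$$ that is, $\ell(\varepsilon,s)\le\widetilde O(X)^{2}$, where $\widetilde O$ hides an absolute constant and factors polylogarithmic in $X$. -/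

import Mathlib

open MeasureTheory ProbabilityTheory
open scoped ENNReal Matrix

/-- A concept: a function on `ℝ^d` with values in `{-1, 1}`. -/
def IsConcept {d : ℕ} (f : EuclideanSpace ℝ (Fin d) → ℝ) : Prop :=
  ∀ x, f x = -1 ∨ f x = 1

/-- `f` is a polynomial threshold function of degree (at most) `q`: it is `x ↦ sign (p x)` for a
polynomial `p` of total degree at most `q`, with the convention `sign 0 = 1`. -/
def IsPTF {d : ℕ} (q : ℕ) (f : EuclideanSpace ℝ (Fin d) → ℝ) : Prop :=
  ∃ p : MvPolynomial (Fin d) ℝ, p.totalDegree ≤ q ∧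
    (∀ x, 0 ≤ MvPolynomial.eval x.ofLp p → f x = 1) ∧
    (∀ x, MvPolynomial.eval x.ofLp p < 0 → f x = -1)

/-- `f` has intrinsic dimension `k`: `f x = F (W x)` for a concept `F` on `ℝ^k` and a `k × d`
matrix `W` with orthonormal rows. -/
def HasIntrinsicDimension {d : ℕ} (k : ℕ) (f : EuclideanSpace ℝ (Fin d) → ℝ) : Prop :=
  ∃ (F : EuclideanSpace ℝ (Fin k) → ℝ) (W : Matrix (Fin k) (Fin d) ℝ),
    IsConcept F ∧ W * Wᵀ = 1 ∧ ∀ x, f x = F (WithLp.toLp 2 (W *ᵥ x.ofLp))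

/-- The class of degree-`q` polynomial threshold functions on `ℝ^d` with intrinsic dimension
`k`. -/
def ptfClass (d q k : ℕ) : Set (EuclideanSpace ℝ (Fin d) → ℝ) :=
  {f | IsPTF q f ∧ HasIntrinsicDimension k f}

/-- `f` has `(ε, s)`-sandwiching polynomials of degree at most `ℓ` with respect to `μ`. The
`L_s` norm is the extended one, `(∫⁻ |p_up - p_down| ^ s) ^ (1 / s)`, infinite if the integral
diverges. -/
def HasSandwichingPolynomials {d : ℕ} (μ : Measure (EuclideanSpace ℝ (Fin d))) (ε s : ℝ)
    (f : EuclideanSpace ℝ (Fin d) → ℝ) (ℓ : ℕ) : Prop :=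
  ∃ pUp pDown : MvPolynomial (Fin d) ℝ, pUp.totalDegree ≤ ℓ ∧ pDown.totalDegree ≤ ℓ ∧
    (∀ x : EuclideanSpace ℝ (Fin d),
      MvPolynomial.eval x.ofLp pDown ≤ f x ∧ f x ≤ MvPolynomial.eval x.ofLp pUp) ∧
    eLpNorm (fun x : EuclideanSpace ℝ (Fin d) =>
      MvPolynomial.eval x.ofLp pUp - MvPolynomial.eval x.ofLp pDown) (ENNReal.ofReal s) μ
      ≤ ENNReal.ofReal ε

/-- The `(ε, s)`-sandwiching degree of `f` with respect to `μ`: the least degree for which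
sandwiching polynomials exist, and `⊤` if there is none. -/
noncomputable def sandwichingDegree {d : ℕ} (μ : Measure (EuclideanSpace ℝ (Fin d))) (ε s : ℝ)
    (f : EuclideanSpace ℝ (Fin d) → ℝ) : ℕ∞ :=
  ⨅ (ℓ : ℕ) (_ : HasSandwichingPolynomials μ ε s f ℓ), (ℓ : ℕ∞)

/-- The `(ε, s)`-sandwiching degree of a class: the supremum over its elements. -/
noncomputable def classSandwichingDegree {d : ℕ} (μ : Measure (EuclideanSpace ℝ (Fin d)))
    (ε s : ℝ) (𝓕 : Set (EuclideanSpace ℝ (Fin d) → ℝ)) : ℕ∞ :=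
  ⨆ f ∈ 𝓕, sandwichingDegree μ ε s f

/-- The quantity `q³ k^(5/2) s / (ε/2)^(s+1)`. -/
noncomputable def ptfComplexity (q k : ℕ) (ε s : ℝ) : ℝ :=
  (q : ℝ) ^ 3 * (k : ℝ) ^ (5 / 2 : ℝ) * s / (ε / 2) ^ (s + 1)

/-! Since the rows of `W` are orthonormal, the problem descends to `ℝ^k`: `F = f ∘ Wᵀ` is again a
threshold function of degree `q`, `W` maps Gaussian to Gaussian, and sandwiching polynomials pull
back along `W` without gaining degree.

On `ℝ^k` the main point is that `f` is constant on the `ρ`-ball around every point outside a set of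
Gaussian measure at most `16 q³ k ρ` (`IsPTF.exists_stable_off_small_set`). For independent Gaussian
`x, y`, the polynomial `t ↦ p (x + t y)` has a complex root with `|t| ≤ h` with probability at most
`q k h`: the component of `x` along `y` would have to fall near one of at most `q` roots. If fewer
than half of the directions `y` see such a root from `x`, some root-free `y` is also generic for the
degree-`j` Taylor component of `p` at `x`. Absence of roots bounds the coefficients along `y` by `|p
x|` (`norm_coeff_le_of_no_small_roots`), anticoncentration carries the bound to all directions, and
for `h = 8 q² ρ` the Taylor terms decay geometrically, so `p` keeps its sign.

Next, `f` is replaced by its least majorant of slope `2/ρ`, which agrees with `f` off the small set.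
A tensor product of positive Jackson-type kernels approximates it on a cube of half-side `R` with
error of order `R √k / (ρ n)` (`exists_mvPolynomial_approx`), and a radial monomial of degree `2kn`
dominates everything outside the cube (`exists_upper_mvPolynomial`). The same construction for `-f`
gives the lower polynomial.

With `1/ρ` of order `q³ k (2/ε)^s` and `R²` of order `k n s`, the tail is negligible and the error
is at most of order `ε/s` once `n` is of order `(q³ k² (2/ε)^(s+1))² s³`. The degree `2kn` is then
`X² s` up to a constant, and the spare factor `s` is at most `(2 log (X + 2))²` because `X ≥
2^(s+1)`. -/

/-! ### Resampling a standard Gaussian along a direction -/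

section Resample

variable {E : Type*} [NormedAddCommGroup E] [InnerProductSpace ℝ E] [FiniteDimensional ℝ E]
  [MeasurableSpace E] [BorelSpace E]

/-- Replace the component of `x` in direction `v` by `τ`. -/
noncomputable def resampleAlong (v : E) (z : E × ℝ) : E := z.1 - inner ℝ v z.1 • v + z.2 • v

omit [FiniteDimensional ℝ E] [MeasurableSpace E] [BorelSpace E] in
theorem continuous_resampleAlong (v : E) : Continuous (resampleAlong v) := by
  unfold resampleAlong; fun_prop

/-- Compared through characteristic functions: the frequency `t` splits into its part orthogonal to
`v` and the scalar `⟪v, t⟫`, and the two Gaussian exponents add up by Pythagoras. -/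
theorem map_resampleAlong {v : E} (hv : ‖v‖ = 1) :
    ((stdGaussian E).prod (gaussianReal 0 1)).map (resampleAlong v) = stdGaussian E := by
  have hm : Measurable (resampleAlong v) := (continuous_resampleAlong v).measurable
  have : IsProbabilityMeasure (((stdGaussian E).prod (gaussianReal 0 1)).map (resampleAlong v)) :=
    Measure.isProbabilityMeasure_map hm.aemeasurable
  apply Measure.ext_of_charFun
  ext t
  rw [charFun_apply, integral_map hm.aemeasurable (by fun_prop)]
  have h : ∀ z : E × ℝ, Complex.exp (inner ℝ (resampleAlong v z) t * Complex.I) =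
      Complex.exp (inner ℝ z.1 (t - inner ℝ v t • v) * Complex.I) *
        Complex.exp ((inner ℝ v t : ℝ) * z.2 * Complex.I) := by
    intro z
    rw [← Complex.exp_add]
    congr 1
    simp only [resampleAlong, inner_add_left, inner_sub_left, inner_smul_left, inner_sub_right,
      inner_smul_right, real_inner_comm v z.1]
    push_cast
    simp
    ring
  simp_rw [h]
  rw [integral_prod_mul (fun x : E => Complex.exp (inner ℝ x (t - inner ℝ v t • v) * Complex.I))
    (fun τ : ℝ => Complex.exp ((inner ℝ v t : ℝ) * τ * Complex.I)), ← charFun_apply,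
    ← charFun_apply_real, charFun_gaussianReal, charFun_stdGaussian, charFun_stdGaussian,
    ← Complex.exp_add]
  congr 1
  have h2 : ‖t - inner ℝ v t • v‖ ^ 2 = ‖t‖ ^ 2 - (inner ℝ v t) ^ 2 := by
    rw [norm_sub_sq_real, inner_smul_right, norm_smul, hv, real_inner_comm v t]
    simp
    ring
  have h3 : ((‖t - inner ℝ v t • v‖ : ℝ) : ℂ) ^ 2 = (‖t‖ : ℂ) ^ 2 - (inner ℝ v t : ℝ) ^ 2 := by
    exact_mod_cast congrArg (fun r : ℝ => (r : ℂ)) h2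
  rw [h3]
  push_cast
  ring

/-- Fubini after resampling: conditionally on the component orthogonal to `v`, the point is a
one-dimensional Gaussian on a line. This reduces the measure bounds on zero sets to one variable. -/
theorem stdGaussian_le_of_forall_line {v : E} (hv : ‖v‖ = 1) {s : Set E} (hs : MeasurableSet s)
    {b : ℝ≥0∞} (h : ∀ x, gaussianReal 0 1 {τ | x + τ • v ∈ s} ≤ b) : stdGaussian E s ≤ b := by
  have hm : Measurable (resampleAlong v) := (continuous_resampleAlong v).measurable
  rw [← map_resampleAlong hv, Measure.map_apply hm hs, Measure.prod_apply (hm hs)]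
  calc _ ≤ ∫⁻ _ : E, b ∂(stdGaussian E) := lintegral_mono fun x => h (x - inner ℝ v x • v)
    _ = b := by simp

end Resample

/-! ### Complex roots near a Gaussian point of the line -/

theorem gaussianReal_closedBall_le (a η : ℝ) :
    gaussianReal 0 1 {τ : ℝ | |τ - a| ≤ η} ≤ ENNReal.ofReal η := by
  have hset : {τ : ℝ | |τ - a| ≤ η} = Metric.closedBall a η := by
    ext τ; simp [Real.dist_eq]
  -- The density is at most `1/√(2π) ≤ 1/2`, and the interval has length `2η`.
  have hpdf : ∀ x : ℝ, gaussianPDF 0 1 x ≤ ENNReal.ofReal (1 / 2) := by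
    intro x
    apply ENNReal.ofReal_le_ofReal
    have h1 : (2 : ℝ) ≤ √(2 * Real.pi * ((1 : NNReal) : ℝ)) := by
      apply Real.le_sqrt_of_sq_le
      have := Real.pi_gt_three
      simp
      linarith
    have h2 : Real.exp (-(x - 0) ^ 2 / (2 * ((1 : NNReal) : ℝ))) ≤ 1 := by
      apply Real.exp_le_one_iff.2
      have := sq_nonneg (x - 0)
      simp
      nlinarith
    have h3 : (√(2 * Real.pi * ((1 : NNReal) : ℝ)))⁻¹ ≤ 1 / 2 := by
      rw [one_div]; exact inv_anti₀ (by norm_num) h1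
    rw [gaussianPDFReal_def]
    calc _ ≤ (1 / 2 : ℝ) * 1 := mul_le_mul h3 h2 (Real.exp_nonneg _) (by norm_num)
      _ = 1 / 2 := by norm_num
  rw [hset, gaussianReal_apply _ one_ne_zero]
  calc _ ≤ ∫⁻ _ in Metric.closedBall a η, ENNReal.ofReal (1 / 2) := lintegral_mono fun x => hpdf x
    _ = ENNReal.ofReal η := by
      rw [setLIntegral_const, Real.volume_closedBall, ← ENNReal.ofReal_mul (by norm_num)]
      congr 1; ring

theorem gaussianReal_root_near_le (G : Polynomial ℂ) (η : ℝ) {n : ℕ}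
    (hn : G.natDegree ≤ n) :
    gaussianReal 0 1 {τ : ℝ | ∃ r ∈ G.roots, ‖(τ : ℂ) - r‖ ≤ η} ≤ n * ENNReal.ofReal η := by
  classical
  have hsub : {τ : ℝ | ∃ r ∈ G.roots, ‖(τ : ℂ) - r‖ ≤ η} ⊆
      ⋃ r ∈ G.roots.toFinset, {τ : ℝ | |τ - r.re| ≤ η} := by
    rintro τ ⟨r, hr, hτ⟩
    simp only [Set.mem_iUnion]
    refine ⟨r, by simpa using hr, ?_⟩
    have := Complex.abs_re_le_norm ((τ : ℂ) - r)
    simp at this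
    exact this.trans hτ
  have hcard : (G.roots.toFinset.card : ℕ) ≤ n :=
    (Multiset.toFinset_card_le _).trans ((Polynomial.card_roots' G).trans hn)
  calc _ ≤ _ := measure_mono hsub
    _ ≤ ∑ r ∈ G.roots.toFinset, gaussianReal 0 1 {τ : ℝ | |τ - r.re| ≤ η} :=
      measure_biUnion_finset_le _ _
    _ ≤ ∑ r ∈ G.roots.toFinset, ENNReal.ofReal η :=
      Finset.sum_le_sum fun r _ => gaussianReal_closedBall_le _ _
    _ = G.roots.toFinset.card * ENNReal.ofReal η := by simp
    _ ≤ n * ENNReal.ofReal η := by gcongr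

theorem norm_leadingCoeff_mul_pow_le_norm_eval {G : Polynomial ℂ} {η : ℝ} (hη : 0 ≤ η)
    {z : ℂ} (h : ∀ r ∈ G.roots, η ≤ ‖z - r‖) :
    ‖G.leadingCoeff‖ * η ^ G.natDegree ≤ ‖G.eval z‖ := by
  have hs := IsAlgClosed.splits G
  have h1 := hs.eq_prod_roots
  rw [hs.natDegree_eq_card_roots]
  conv_rhs => rw [h1]
  rw [Polynomial.eval_mul, Polynomial.eval_C, norm_mul]
  gcongr
  rw [Polynomial.eval_multiset_prod, Multiset.map_map]
  have : ∀ S : Multiset ℂ, (∀ r ∈ S, η ≤ ‖z - r‖) →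
      η ^ Multiset.card S ≤
        ‖(S.map (Polynomial.eval z ∘ fun r => Polynomial.X - Polynomial.C r)).prod‖ := by
    intro S
    induction S using Multiset.induction with
    | empty => simp
    | cons a S ih =>
      intro hS
      rw [Multiset.card_cons, Multiset.map_cons, Multiset.prod_cons, norm_mul, pow_succ']
      have h1 := hS a (by simp)
      have h2 := ih fun r hr => hS r (by simp [hr])
      simp only [Function.comp, Polynomial.eval_sub, Polynomial.eval_X, Polynomial.eval_C] at h2 ⊢
      exact mul_le_mul h1 h2 (by positivity) (norm_nonneg _)
  exact this _ h

/-- Up to the factor `g 0`, `g` is a product of factors `1 - z/r` with `|r| > h`, so its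
coefficients are elementary symmetric functions of numbers smaller than `1/h`. The induction removes
one root at a time and closes with Pascal's rule. -/
theorem norm_coeff_le_of_no_small_roots {h : ℝ} (hh : 0 < h) :
    ∀ (n : ℕ) (g : Polynomial ℂ), g.natDegree ≤ n → (∀ z, ‖z‖ ≤ h → g.eval z ≠ 0) →
      ∀ j, ‖g.coeff j‖ ≤ n.choose j * (h ^ j)⁻¹ * ‖g.coeff 0‖ := by
  intro n
  induction n with
  | zero =>
    intro g hg _ j
    rw [Polynomial.eq_C_of_natDegree_le_zero hg]
    cases j <;> simp [Polynomial.coeff_C]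
  | succ n ih =>
    intro g hg hr j
    by_cases hd : g.natDegree ≤ n
    · refine (ih g hd hr j).trans ?_
      have : (n.choose j : ℝ) ≤ (n + 1).choose j := by
        exact_mod_cast Nat.choose_le_choose j (Nat.le_succ n)
      gcongr
    · have hdeg : g.degree ≠ 0 := by
        intro h0
        exact hd (by rw [Polynomial.natDegree_eq_zero_iff_degree_le_zero.2 h0.le]; exact zero_le)
      obtain ⟨r, hr0⟩ := IsAlgClosed.exists_root g hdeg
      obtain ⟨g₁, rfl⟩ := Polynomial.dvd_iff_isRoot.2 hr0
      have hrh : h < ‖r‖ := by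
        by_contra hcon
        exact hr r (not_lt.1 hcon) hr0
      have hg1 : g₁ ≠ 0 := by
        rintro rfl
        exact hd (by simp)
      have hdeg1 : g₁.natDegree ≤ n := by
        rw [Polynomial.natDegree_mul (Polynomial.X_sub_C_ne_zero r) hg1,
          Polynomial.natDegree_X_sub_C] at hg
        omega
      have hr1 : ∀ z, ‖z‖ ≤ h → g₁.eval z ≠ 0 := by
        intro z hz h0
        exact hr z hz (by simp [h0])
      have hc0 : ‖((Polynomial.X - Polynomial.C r) * g₁).coeff 0‖ = ‖r‖ * ‖g₁.coeff 0‖ := by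
        simp [Polynomial.mul_coeff_zero]
      have I := ih g₁ hdeg1 hr1
      cases j with
      | zero => simp
      | succ j =>
        rw [hc0]
        have hc : ((Polynomial.X - Polynomial.C r) * g₁).coeff (j + 1) =
            g₁.coeff j - r * g₁.coeff (j + 1) := by
          rw [sub_mul, Polynomial.coeff_sub, Polynomial.coeff_X_mul, Polynomial.coeff_C_mul]
        rw [hc]
        calc _ ≤ ‖g₁.coeff j‖ + ‖r‖ * ‖g₁.coeff (j + 1)‖ := by
              rw [← norm_mul]; exact norm_sub_le _ _
          _ ≤ n.choose j * (h ^ j)⁻¹ * ‖g₁.coeff 0‖ +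
                ‖r‖ * (n.choose (j + 1) * (h ^ (j + 1))⁻¹ * ‖g₁.coeff 0‖) := by
              gcongr
              · exact I j
              · exact I (j + 1)
          -- One factor `‖r‖/h ≥ 1` is inserted so that both terms carry `‖r‖ * ‖g₁.coeff 0‖`, the
          -- constant term of the product.
          _ ≤ n.choose j * ((h ^ (j + 1))⁻¹ * ‖r‖) * ‖g₁.coeff 0‖ +
                ‖r‖ * (n.choose (j + 1) * (h ^ (j + 1))⁻¹ * ‖g₁.coeff 0‖) := by
              gcongr
              rw [pow_succ, mul_inv, mul_assoc]
              exact le_mul_of_one_le_right (by positivity) (by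
                rw [inv_mul_eq_div, one_le_div hh]; exact hrh.le)
          _ = _ := by
              rw [Nat.choose_succ_succ]; push_cast; ring

/-! ### Restriction of a multivariate polynomial to a line -/

section Line

open Polynomial

variable {σ : Type*}

/-- The restriction `z ↦ p (a + z v)` of a real polynomial to a line, with complex parameter. -/
noncomputable def lineRestriction (p : MvPolynomial σ ℝ) (a v : σ → ℝ) : ℂ[X] :=
  MvPolynomial.aeval (fun i => C (a i : ℂ) + C (v i : ℂ) * X) p

theorem eval_lineRestriction (p : MvPolynomial σ ℝ) (a v : σ → ℝ) (z : ℂ) :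
    (lineRestriction p a v).eval z =
      MvPolynomial.aeval (fun i => (a i : ℂ) + v i * z) p := by
  have h := MvPolynomial.map_aeval (R := ℝ) (fun i => (C (a i : ℂ) + C (v i : ℂ) * X : ℂ[X]))
    (Polynomial.evalRingHom z) p
  simp only [Polynomial.coe_evalRingHom] at h
  rw [lineRestriction, h, MvPolynomial.aeval_def, MvPolynomial.coe_eval₂Hom]
  congr 1
  · ext; simp
  · ext i; simp

theorem eval_lineRestriction_ofReal (p : MvPolynomial σ ℝ) (a v : σ → ℝ) (t : ℝ) :
    (lineRestriction p a v).eval (t : ℂ) = (MvPolynomial.eval (fun i => a i + t * v i) p : ℝ) := by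
  rw [eval_lineRestriction]
  have h := MvPolynomial.aeval_algebraMap_apply ℂ (fun i => a i + t * v i) p
  rw [MvPolynomial.aeval_eq_eval] at h
  refine Eq.trans ?_ h
  congr 2
  ext i
  simp [mul_comm]

theorem lineRestriction_eq_sum (p : MvPolynomial σ ℝ) (a v : σ → ℝ) :
    lineRestriction p a v = ∑ s ∈ p.support, C (Complex.ofReal (p.coeff s)) *
      ((Finsupp.toMultiset s).map fun i => (C (a i : ℂ) + C (v i : ℂ) * X : ℂ[X])).prod := by
  classical
  rw [lineRestriction, MvPolynomial.aeval_def, MvPolynomial.eval₂_eq]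
  refine Finset.sum_congr rfl fun s _ => ?_
  congr 1
  rw [Finsupp.toMultiset_map, Finsupp.prod_toMultiset, Finsupp.prod_mapDomain_index] <;>
    simp [pow_add, Finsupp.prod]

theorem card_toMultiset_eq_degree (s : σ →₀ ℕ) :
    Multiset.card (Finsupp.toMultiset s) = s.degree := by
  rw [Finsupp.card_toMultiset, Finsupp.degree_apply, Finsupp.sum]
  rfl

theorem natDegree_map_linear_prod_le (s : σ →₀ ℕ) (a v : σ → ℝ) :
    ((Finsupp.toMultiset s).map fun i => (C (a i : ℂ) + C (v i : ℂ) * X : ℂ[X])).prod.natDegree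
      ≤ s.degree := by
  refine (Polynomial.natDegree_multiset_prod_le _).trans ?_
  refine (Multiset.sum_le_card_nsmul _ 1 ?_).trans ?_
  · intro d hd
    simp only [Multiset.map_map, Multiset.mem_map] at hd
    obtain ⟨i, -, rfl⟩ := hd
    simp only [Function.comp]
    compute_degree
  · simp [← card_toMultiset_eq_degree]

theorem coeff_map_linear_prod (s : σ →₀ ℕ) (a v : σ → ℝ) :
    ((Finsupp.toMultiset s).map fun i => (C (a i : ℂ) + C (v i : ℂ) * X : ℂ[X])).prod.coeff
      s.degree = ∏ i ∈ s.support, (v i : ℂ) ^ s i := by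
  classical
  have h2 : ∏ i ∈ s.support, (v i : ℂ) ^ s i =
      ((Finsupp.toMultiset s).map fun i => (v i : ℂ)).prod := by
    rw [Finsupp.toMultiset_map, Finsupp.prod_toMultiset, Finsupp.prod_mapDomain_index] <;>
      simp [pow_add, Finsupp.prod]
  have hlin : ∀ P ∈ (Finsupp.toMultiset s).map fun i => (C (a i : ℂ) + C (v i : ℂ) * X : ℂ[X]),
      P.natDegree ≤ 1 := by
    intro P hP
    obtain ⟨i, -, rfl⟩ := Multiset.mem_map.1 hP
    compute_degree
  have := Polynomial.coeff_multiset_prod_of_natDegree_le _ 1 hlin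
  rw [Multiset.card_map, card_toMultiset_eq_degree, mul_one] at this
  rw [h2, this, Multiset.map_map]
  congr 1
  apply Multiset.map_congr rfl
  intro i _
  simp

theorem natDegree_lineRestriction_le (p : MvPolynomial σ ℝ) (a v : σ → ℝ) :
    (lineRestriction p a v).natDegree ≤ p.totalDegree := by
  rw [lineRestriction_eq_sum]
  refine Polynomial.natDegree_sum_le_of_forall_le _ _ fun s hs => ?_
  refine (Polynomial.natDegree_C_mul_le _ _).trans ((natDegree_map_linear_prod_le s a v).trans ?_)
  rw [Finsupp.degree_apply]
  exact MvPolynomial.le_totalDegree hs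

/-- Only monomials of full degree `n` reach `z^n`, and each contributes its value at `v`. The
coefficient is therefore independent of the base point `a`. -/
theorem coeff_lineRestriction (p : MvPolynomial σ ℝ) (a v : σ → ℝ) {n : ℕ}
    (hn : p.totalDegree ≤ n) :
    (lineRestriction p a v).coeff n =
      (MvPolynomial.eval v (MvPolynomial.homogeneousComponent n p) : ℝ) := by
  rw [lineRestriction_eq_sum, Polynomial.finsetSum_coeff, MvPolynomial.homogeneousComponent_apply,
    map_sum, Finset.sum_filter, Complex.ofReal_sum]
  refine Finset.sum_congr rfl fun s hs => ?_
  have hsn : s.degree ≤ n := by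
    rw [Finsupp.degree_apply]
    exact (MvPolynomial.le_totalDegree hs).trans hn
  rw [Polynomial.coeff_C_mul]
  split_ifs with h
  · rw [← h, coeff_map_linear_prod, MvPolynomial.eval_monomial, Finsupp.prod]
    push_cast
    rfl
  · rw [Polynomial.coeff_eq_zero_of_natDegree_lt]
    · simp
    · exact (natDegree_map_linear_prod_le s a v).trans_lt (lt_of_le_of_ne hsn h)

end Line

/-! ### Affine substitutions and Taylor expansion at a point -/

section Substitution

variable {σ τ : Type*}

theorem totalDegree_aeval_le_of_affine (p : MvPolynomial σ ℝ) (f : σ → MvPolynomial τ ℝ)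
    (hf : ∀ i, (f i).totalDegree ≤ 1) : (MvPolynomial.aeval f p).totalDegree ≤ p.totalDegree := by
  classical
  rw [MvPolynomial.aeval_def, MvPolynomial.eval₂_eq]
  refine MvPolynomial.totalDegree_finsetSum_le fun s hs => ?_
  refine (MvPolynomial.totalDegree_mul _ _).trans ?_
  rw [MvPolynomial.algebraMap_eq, MvPolynomial.totalDegree_C, zero_add]
  refine (MvPolynomial.totalDegree_finsetProd _ _).trans ?_
  refine le_trans (Finset.sum_le_sum fun i _ => ?_) (MvPolynomial.le_totalDegree hs)
  exact (MvPolynomial.totalDegree_pow _ _).trans (by simpa using Nat.mul_le_mul_left (s i) (hf i))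

theorem eval_aeval_mvPolynomial (p : MvPolynomial σ ℝ) (f : σ → MvPolynomial τ ℝ) (y : τ → ℝ) :
    MvPolynomial.eval y (MvPolynomial.aeval f p) =
      MvPolynomial.eval (fun i => MvPolynomial.eval y (f i)) p := by
  have h := MvPolynomial.map_aeval (R := ℝ) f (MvPolynomial.eval y) p
  rw [h, MvPolynomial.coe_eval₂Hom]
  rw [MvPolynomial.eval, MvPolynomial.coe_eval₂Hom]
  congr 1
  ext; simp

/-- The polynomial `u ↦ p (x + u)`. -/
noncomputable def translatePoly (p : MvPolynomial σ ℝ) (x : σ → ℝ) : MvPolynomial σ ℝ :=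
  MvPolynomial.aeval (fun i => MvPolynomial.X i + MvPolynomial.C (x i)) p

theorem eval_translatePoly (p : MvPolynomial σ ℝ) (x u : σ → ℝ) :
    MvPolynomial.eval u (translatePoly p x) = MvPolynomial.eval (fun i => x i + u i) p := by
  rw [translatePoly, eval_aeval_mvPolynomial]
  congr 2
  ext i
  simp [add_comm]

theorem totalDegree_translatePoly_le (p : MvPolynomial σ ℝ) (x : σ → ℝ) :
    (translatePoly p x).totalDegree ≤ p.totalDegree := by
  apply totalDegree_aeval_le_of_affine
  intro i
  refine (MvPolynomial.totalDegree_add _ _).trans ?_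
  simp [MvPolynomial.totalDegree_X]

theorem eval_lineRestriction_translatePoly (p : MvPolynomial σ ℝ) (x y : σ → ℝ) (z : ℂ) :
    (lineRestriction (translatePoly p x) 0 y).eval z = (lineRestriction p x y).eval z := by
  rw [eval_lineRestriction, eval_lineRestriction, translatePoly, ← AlgHom.comp_apply]
  congr 1
  apply MvPolynomial.algHom_ext
  intro i
  simp [add_comm]

open Polynomial in
theorem coeff_lineRestriction_zero (p : MvPolynomial σ ℝ) (v : σ → ℝ) (n : ℕ) :
    (lineRestriction p 0 v).coeff n =
      (MvPolynomial.eval v (MvPolynomial.homogeneousComponent n p) : ℝ) := by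
  classical
  rw [lineRestriction_eq_sum, Polynomial.finsetSum_coeff, MvPolynomial.homogeneousComponent_apply,
    map_sum, Finset.sum_filter, Complex.ofReal_sum]
  refine Finset.sum_congr rfl fun s _ => ?_
  have hprod : ((Finsupp.toMultiset s).map
      fun i => (C (((0 : σ → ℝ) i : ℝ) : ℂ) + C (v i : ℂ) * X : ℂ[X])).prod =
      C (∏ i ∈ s.support, (v i : ℂ) ^ s i) * X ^ s.degree := by
    have h2 : ∏ i ∈ s.support, (v i : ℂ) ^ s i =
        ((Finsupp.toMultiset s).map fun i => (v i : ℂ)).prod := by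
      rw [Finsupp.toMultiset_map, Finsupp.prod_toMultiset, Finsupp.prod_mapDomain_index] <;>
        simp [pow_add, Finsupp.prod]
    rw [h2, ← card_toMultiset_eq_degree]
    simp [Multiset.prod_map_mul, map_multiset_prod, Multiset.map_map]
  rw [hprod, Polynomial.coeff_C_mul, Polynomial.coeff_C_mul, Polynomial.coeff_X_pow]
  by_cases h : s.degree = n
  · rw [if_pos h, if_pos h.symm, MvPolynomial.eval_monomial, Finsupp.prod]
    push_cast
    simp
  · rw [if_neg h, if_neg (Ne.symm h)]
    simp

end Substitution

/-! ### Gaussian measure of the region where a polynomial may change sign nearby -/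

section Tube

variable {k : ℕ}

local notation "𝔼" k => EuclideanSpace ℝ (Fin k)

theorem continuous_eval_ofLp (p : MvPolynomial (Fin k) ℝ) :
    Continuous fun x : 𝔼 k => MvPolynomial.eval x.ofLp p :=
  (MvPolynomial.continuous_eval p).comp (PiLp.continuous_ofLp 2 _)

theorem eval_lineRestriction_point (p : MvPolynomial (Fin k) ℝ) (x v : 𝔼 k) (t : ℝ) :
    (lineRestriction p x.ofLp v.ofLp).eval (t : ℂ) =
      (MvPolynomial.eval (x + t • v).ofLp p : ℝ) := by
  rw [eval_lineRestriction_ofReal]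
  rfl

/-- Anticoncentration of a homogeneous polynomial relative to its value at a unit vector. -/
theorem stdGaussian_abs_eval_lt_le {Q : MvPolynomial (Fin k) ℝ} {j : ℕ} (hQ : Q.IsHomogeneous j)
    {w : 𝔼 k} (hw : ‖w‖ = 1) {η : ℝ} (hη : 0 ≤ η) :
    stdGaussian (𝔼 k) {y | |MvPolynomial.eval y.ofLp Q| < |MvPolynomial.eval w.ofLp Q| * η ^ j}
      ≤ j * ENNReal.ofReal η := by
  refine stdGaussian_le_of_forall_line hw ?_ fun x => ?_
  · exact (isOpen_lt (continuous_eval_ofLp Q).abs continuous_const).measurableSet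
  have hdeg := (natDegree_lineRestriction_le Q x.ofLp w.ofLp).trans hQ.totalDegree_le
  refine le_trans (measure_mono ?_) (gaussianReal_root_near_le _ η hdeg)
  intro τ hτ
  simp only [Set.mem_ofPred_eq] at hτ ⊢
  by_contra hcon
  push Not at hcon
  -- Along every line of direction `w` the leading coefficient is `Q w`, so away from the roots by
  -- `η` the restriction is at least `|Q w| η^j`.
  have hcoeff := coeff_lineRestriction Q x.ofLp w.ofLp hQ.totalDegree_le
  rw [MvPolynomial.homogeneousComponent_of_mem hQ, if_pos rfl] at hcoeff
  have hne : MvPolynomial.eval w.ofLp Q ≠ 0 := by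
    intro h0
    rw [h0, abs_zero, zero_mul] at hτ
    exact absurd hτ (not_lt.2 (abs_nonneg _))
  have hnat : (lineRestriction Q x.ofLp w.ofLp).natDegree = j :=
    Polynomial.natDegree_eq_of_le_of_coeff_ne_zero hdeg (by rw [hcoeff]; exact_mod_cast hne)
  have := norm_leadingCoeff_mul_pow_le_norm_eval hη (z := (τ : ℂ)) fun r hr => (hcon r hr).le
  rw [Polynomial.leadingCoeff, hnat, hcoeff, eval_lineRestriction_point, Complex.norm_real,
    Complex.norm_real, Real.norm_eq_abs, Real.norm_eq_abs] at this
  exact absurd hτ (not_lt.2 this)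

theorem exists_eval_homogeneousComponent_totalDegree_ne_zero {p : MvPolynomial (Fin k) ℝ}
    (hp : p ≠ 0) :
    ∃ w : 𝔼 k, MvPolynomial.eval w.ofLp (MvPolynomial.homogeneousComponent p.totalDegree p) ≠ 0 := by
  by_contra! hcon
  have h0 : MvPolynomial.homogeneousComponent p.totalDegree p = 0 := by
    apply MvPolynomial.funext
    intro x
    simpa using hcon (WithLp.toLp 2 x)
  have hne : p.support.Nonempty := MvPolynomial.support_nonempty.2 hp
  obtain ⟨s, hs, hsd⟩ := Finset.exists_mem_eq_sup p.support hne fun s => s.sum fun _ e => e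
  have hc := congrArg (MvPolynomial.coeff s) h0
  rw [MvPolynomial.coeff_homogeneousComponent, if_pos (by
    rw [Finsupp.degree_apply, MvPolynomial.totalDegree, hsd, Finsupp.sum])] at hc
  exact (MvPolynomial.mem_support_iff.1 hs) (by simpa using hc)

theorem eval_smul_homogeneousComponent (p : MvPolynomial (Fin k) ℝ) (n : ℕ) (c : ℝ) (u : 𝔼 k) :
    MvPolynomial.eval (c • u).ofLp (MvPolynomial.homogeneousComponent n p) =
      c ^ n * MvPolynomial.eval u.ofLp (MvPolynomial.homogeneousComponent n p) := by
  rw [MvPolynomial.homogeneousComponent_apply, map_sum, map_sum, Finset.mul_sum]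
  refine Finset.sum_congr rfl fun s hs => ?_
  rw [← (Finset.mem_filter.1 hs).2, MvPolynomial.eval_monomial, MvPolynomial.eval_monomial,
    Finsupp.degree_apply, ← Finset.prod_pow_eq_pow_sum]
  simp only [Finsupp.prod, PiLp.smul_apply, smul_eq_mul, mul_pow, Finset.prod_mul_distrib]
  ring

/-- Anticoncentration with `η → 0`, normalized at a unit vector where the top component does not
vanish. If the only witness available is `0`, the degree is `0` and the component is a nonzero
constant. -/
theorem ae_eval_homogeneousComponent_totalDegree_ne_zero {p : MvPolynomial (Fin k) ℝ}
    (hp : p ≠ 0) : ∀ᵐ y ∂(stdGaussian (𝔼 k)),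
      MvPolynomial.eval y.ofLp (MvPolynomial.homogeneousComponent p.totalDegree p) ≠ 0 := by
  obtain ⟨w, hw⟩ := exists_eval_homogeneousComponent_totalDegree_ne_zero hp
  set Q := MvPolynomial.homogeneousComponent p.totalDegree p with hQdef
  have hQ : Q.IsHomogeneous p.totalDegree := MvPolynomial.homogeneousComponent_isHomogeneous _ _
  by_cases hw0 : w = 0
  · have hdeg : p.totalDegree = 0 := by
      by_contra hd
      have := eval_smul_homogeneousComponent p p.totalDegree 0 w
      rw [zero_pow hd, zero_mul, zero_smul, ← hw0] at this
      exact hw this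
    refine Filter.Eventually.of_forall fun y => ?_
    rw [hQdef, hdeg, MvPolynomial.homogeneousComponent_zero, MvPolynomial.eval_C] at hw ⊢
    exact hw
  have hwn : ‖w‖ ≠ 0 := norm_ne_zero_iff.2 hw0
  set v := ‖w‖⁻¹ • w with hv
  have hv1 : ‖v‖ = 1 := by rw [hv, norm_smul, norm_inv, norm_norm, inv_mul_cancel₀ hwn]
  have hvQ : MvPolynomial.eval v.ofLp Q ≠ 0 := by
    rw [hv, hQdef, eval_smul_homogeneousComponent]
    exact mul_ne_zero (pow_ne_zero _ (inv_ne_zero hwn)) hw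
  rw [ae_iff]
  simp only [ne_eq, not_not]
  refine le_antisymm (ENNReal.le_of_forall_pos_le_add fun δ hδ _ => ?_) zero_le
  rw [zero_add]
  have hpos : (0 : ℝ) < δ / (p.totalDegree + 1) := by positivity
  calc _ ≤ _ := measure_mono ?_
    _ ≤ _ := stdGaussian_abs_eval_lt_le hQ hv1 hpos.le
    _ = ENNReal.ofReal (p.totalDegree * (δ / (p.totalDegree + 1))) := by
      rw [ENNReal.ofReal_mul (by positivity), ENNReal.ofReal_natCast]
    _ ≤ ENNReal.ofReal δ := by
      apply ENNReal.ofReal_le_ofReal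
      rw [mul_div_assoc', div_le_iff₀ (by positivity), mul_comm]
      gcongr
      linarith
    _ = δ := ENNReal.ofReal_coe_nnreal
  intro y hy
  simp only [Set.mem_ofPred_eq] at hy ⊢
  rw [hy, abs_zero]
  positivity

/-- The pairs `(x, y)` for which the line `t ↦ x + t y` has a complex zero of `p` with
`|t| ≤ h`. -/
def smallRootSet (p : MvPolynomial (Fin k) ℝ) (h : ℝ) : Set ((𝔼 k) × (𝔼 k)) :=
  {z | ∃ t : ℂ, ‖t‖ ≤ h ∧ (lineRestriction p z.1.ofLp z.2.ofLp).eval t = 0}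

/-- The set is the projection of a closed set along the compact disc of parameters `t`; closedness
supplies the measurability needed for Fubini. -/
theorem isClosed_smallRootSet (p : MvPolynomial (Fin k) ℝ) (h : ℝ) :
    IsClosed (smallRootSet p h) := by
  have : CompactSpace (Metric.closedBall (0 : ℂ) h) :=
    isCompact_iff_compactSpace.1 (isCompact_closedBall 0 h)
  let S : Set (Metric.closedBall (0 : ℂ) h × ((𝔼 k) × (𝔼 k))) :=
    {a | (lineRestriction p a.2.1.ofLp a.2.2.ofLp).eval (a.1 : ℂ) = 0}
  have hS : IsClosed S := by
    apply isClosed_eq _ continuous_const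
    simp only [eval_lineRestriction, MvPolynomial.aeval_def, MvPolynomial.eval₂_eq']
    fun_prop
  have himg : smallRootSet p h = Prod.snd '' S := by
    ext z
    constructor
    · rintro ⟨t, ht, hz⟩
      exact ⟨(⟨t, by simpa using ht⟩, z), hz, rfl⟩
    · rintro ⟨⟨t, z'⟩, ha, rfl⟩
      exact ⟨t, mem_closedBall_zero_iff.1 t.2, ha⟩
  rw [himg]
  exact isClosedMap_snd_of_compactSpace S hS

/-- Resample `x` along `v = y/‖y‖`. A zero at parameter `t` from `x + τ v` is a root at `τ + ‖y‖ t`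
of the restriction along `v`, so `τ` lies within `‖y‖ h` of one of at most `q` roots. The condition
on `y` keeps every restriction nonzero. -/
theorem stdGaussian_smallRootSet_section_le {p : MvPolynomial (Fin k) ℝ} {q : ℕ}
    (hq : p.totalDegree ≤ q) {h : ℝ} (y : 𝔼 k)
    (hy : MvPolynomial.eval y.ofLp (MvPolynomial.homogeneousComponent p.totalDegree p) ≠ 0) :
    stdGaussian (𝔼 k) {x | (x, y) ∈ smallRootSet p h} ≤ q * ENNReal.ofReal (‖y‖ * h) := by
  have hG : ∀ (x : 𝔼 k), lineRestriction p x.ofLp y.ofLp ≠ 0 := by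
    intro x h0
    have := coeff_lineRestriction p x.ofLp y.ofLp le_rfl
    rw [h0, Polynomial.coeff_zero] at this
    exact hy (by exact_mod_cast this.symm)
  by_cases hy0 : y = 0
  · have : {x : 𝔼 k | (x, y) ∈ smallRootSet p h} = ∅ := by
      ext x
      simp only [Set.mem_empty_iff_false, iff_false]
      rintro ⟨t, -, ht⟩
      apply hG x
      apply Polynomial.funext
      intro z
      rw [Polynomial.eval_zero, ← ht, eval_lineRestriction, eval_lineRestriction, hy0]
      simp
    rw [this, measure_empty]
    exact zero_le
  have hyn : ‖y‖ ≠ 0 := norm_ne_zero_iff.2 hy0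
  have hyp : 0 < ‖y‖ := norm_pos_iff.2 hy0
  set v := ‖y‖⁻¹ • y with hv
  have hv1 : ‖v‖ = 1 := by rw [hv, norm_smul, norm_inv, norm_norm, inv_mul_cancel₀ hyn]
  have hyv : y = ‖y‖ • v := by rw [hv, smul_smul, mul_inv_cancel₀ hyn, one_smul]
  refine stdGaussian_le_of_forall_line hv1 ?_ fun x => ?_
  · exact ((isClosed_smallRootSet p h).preimage (by fun_prop :
      Continuous fun x : 𝔼 k => (x, y))).measurableSet
  refine le_trans (measure_mono ?_) (gaussianReal_root_near_le
    (lineRestriction p x.ofLp v.ofLp) _ ((natDegree_lineRestriction_le p _ _).trans hq))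
  rintro τ ⟨t, ht, hz⟩
  have key : ∀ z : ℂ, (lineRestriction p (x + τ • v).ofLp y.ofLp).eval z =
      (lineRestriction p x.ofLp v.ofLp).eval (τ + ‖y‖ * z) := by
    intro z
    rw [eval_lineRestriction, eval_lineRestriction]
    congr 2
    ext i
    conv_lhs => rw [show y.ofLp i = ‖y‖ * v.ofLp i from congrArg (fun u : 𝔼 k => u.ofLp i) hyv]
    simp
    ring
  refine ⟨τ + ‖y‖ * t, ?_, ?_⟩
  · rw [Polynomial.mem_roots']
    refine ⟨?_, ?_⟩
    · intro h0
      apply hG (x + (0 : ℝ) • v)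
      apply Polynomial.funext
      intro z
      have : (lineRestriction p (x + (0 : ℝ) • v).ofLp y.ofLp).eval z =
          (lineRestriction p x.ofLp v.ofLp).eval (‖y‖ * z) := by
        rw [eval_lineRestriction, eval_lineRestriction]
        congr 2
        ext i
        conv_lhs =>
          rw [show y.ofLp i = ‖y‖ * v.ofLp i from congrArg (fun u : 𝔼 k => u.ofLp i) hyv]
        simp
        ring
      rw [this, h0]
      simp
    · rw [Polynomial.IsRoot, ← key]
      exact hz
  · rw [sub_add_cancel_left, norm_neg, norm_mul, Complex.norm_real, norm_norm]
    gcongr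

theorem lintegral_norm_stdGaussian_le :
    ∫⁻ y, ENNReal.ofReal ‖y‖ ∂(stdGaussian (𝔼 k)) ≤ k := by
  have h1 : ∫⁻ t, ENNReal.ofReal |t| ∂(gaussianReal 0 1) ≤ 1 := by
    have hsq : Integrable (fun t : ℝ => t ^ 2) (gaussianReal 0 1) :=
      (memLp_id_gaussianReal 2).integrable_sq
    have hint : ∫ t, t ^ 2 ∂(gaussianReal 0 1) = 1 := by
      have := variance_id_gaussianReal (μ := 0) (v := 1)
      rw [variance_eq_sub (memLp_id_gaussianReal 2)] at this
      simpa using this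
    calc _ ≤ ∫⁻ t, ENNReal.ofReal ((1 + t ^ 2) / 2) ∂(gaussianReal 0 1) := by
          refine lintegral_mono fun t => ENNReal.ofReal_le_ofReal ?_
          -- The bound `|t| ≤ (1 + t²)/2` reduces the first moment to the variance.
          nlinarith [sq_nonneg (|t| - 1), sq_abs t]
      _ = ENNReal.ofReal (∫ t, (1 + t ^ 2) / 2 ∂(gaussianReal 0 1)) := by
          rw [ofReal_integral_eq_lintegral_ofReal]
          · exact ((integrable_const 1).add hsq).div_const 2
          · exact Filter.Eventually.of_forall fun t => by positivity
      _ = 1 := by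
          rw [integral_div, integral_add (integrable_const 1) hsq, hint]
          norm_num
  rw [← map_pi_eq_stdGaussian, lintegral_map (by fun_prop) (by fun_prop)]
  calc _ ≤ ∫⁻ x : Fin k → ℝ, ∑ i, ENNReal.ofReal |x i| ∂(Measure.pi fun _ => gaussianReal 0 1) := by
        refine lintegral_mono fun x => ?_
        rw [← ENNReal.ofReal_sum_of_nonneg fun i _ => abs_nonneg _]
        apply ENNReal.ofReal_le_ofReal
        rw [EuclideanSpace.norm_eq]
        apply Real.sqrt_le_iff.2
        refine ⟨Finset.sum_nonneg fun i _ => abs_nonneg _, ?_⟩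
        exact Finset.sum_sq_le_sq_sum_of_nonneg fun i _ => abs_nonneg _
    _ = ∑ i : Fin k, ∫⁻ x : Fin k → ℝ, ENNReal.ofReal |x i| ∂(Measure.pi fun _ => gaussianReal 0 1) :=
        lintegral_finsetSum _ fun i _ => by fun_prop
    _ = ∑ i : Fin k, ∫⁻ t, ENNReal.ofReal |t| ∂(gaussianReal 0 1) := by
        refine Finset.sum_congr rfl fun i _ => ?_
        exact (measurePreserving_eval (fun _ : Fin k => gaussianReal 0 1) i).lintegral_comp
          (f := fun t => ENNReal.ofReal |t|) (by fun_prop)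
    _ ≤ ∑ i : Fin k, 1 := Finset.sum_le_sum fun i _ => h1
    _ = k := by simp

theorem prod_smallRootSet_le {p : MvPolynomial (Fin k) ℝ} (hp : p ≠ 0) {q : ℕ}
    (hq : p.totalDegree ≤ q) (h : ℝ) :
    ((stdGaussian (𝔼 k)).prod (stdGaussian (𝔼 k))) (smallRootSet p h) ≤
      ENNReal.ofReal (q * k * h) := by
  rw [Measure.prod_apply_symm (isClosed_smallRootSet p h).measurableSet]
  calc _ ≤ ∫⁻ y, q * ENNReal.ofReal h * ENNReal.ofReal ‖y‖ ∂(stdGaussian (𝔼 k)) := by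
        apply lintegral_mono_ae
        filter_upwards [ae_eval_homogeneousComponent_totalDegree_ne_zero hp] with y hy
        refine (stdGaussian_smallRootSet_section_le hq y hy).trans_eq ?_
        rw [ENNReal.ofReal_mul (norm_nonneg _)]
        ring
    _ = q * ENNReal.ofReal h * ∫⁻ y, ENNReal.ofReal ‖y‖ ∂(stdGaussian (𝔼 k)) :=
        lintegral_const_mul _ (by fun_prop)
    _ ≤ q * ENNReal.ofReal h * k := by gcongr; exact lintegral_norm_stdGaussian_le
    _ = _ := by
        rw [ENNReal.ofReal_mul (by positivity), ENNReal.ofReal_mul (by positivity),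
          ENNReal.ofReal_natCast, ENNReal.ofReal_natCast]
        ring

/-- The points `x` such that, for at least half of the Gaussian directions `y`, the line
`t ↦ x + t y` has a complex zero of `p` with `|t| ≤ h`. -/
def nearZeroSet (p : MvPolynomial (Fin k) ℝ) (h : ℝ) : Set (𝔼 k) :=
  {x | 2⁻¹ ≤ stdGaussian (𝔼 k) (Prod.mk x ⁻¹' smallRootSet p h)}

theorem measurableSet_nearZeroSet (p : MvPolynomial (Fin k) ℝ) (h : ℝ) :
    MeasurableSet (nearZeroSet p h) :=
  measurableSet_le measurable_const
    (measurable_measure_prodMk_left (isClosed_smallRootSet p h).measurableSet)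

/-- Markov's inequality at level `1/2` for the measure of bad directions. -/
theorem stdGaussian_nearZeroSet_le {p : MvPolynomial (Fin k) ℝ} (hp : p ≠ 0) {q : ℕ}
    (hq : p.totalDegree ≤ q) (h : ℝ) :
    stdGaussian (𝔼 k) (nearZeroSet p h) ≤ ENNReal.ofReal (2 * q * k * h) := by
  have h1 := mul_meas_ge_le_lintegral (μ := stdGaussian (𝔼 k))
    (measurable_measure_prodMk_left (ν := stdGaussian (𝔼 k))
      (isClosed_smallRootSet p h).measurableSet) 2⁻¹
  rw [← Measure.prod_apply (isClosed_smallRootSet p h).measurableSet] at h1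
  have h2 := h1.trans (prod_smallRootSet_le hp hq h)
  calc stdGaussian (𝔼 k) (nearZeroSet p h)
      = 2 * (2⁻¹ * stdGaussian (𝔼 k) (nearZeroSet p h)) := by
        rw [← mul_assoc, ENNReal.mul_inv_cancel (by norm_num) (by norm_num), one_mul]
    _ ≤ 2 * ENNReal.ofReal (q * k * h) := by gcongr; exact h2
    _ = ENNReal.ofReal (2 * q * k * h) := by
        rw [show (2 : ℝ≥0∞) = ENNReal.ofReal 2 by simp, ← ENNReal.ofReal_mul (by norm_num)]
        congr 1; ring

/-- Some direction `y` is free of small roots and also generic for the degree-`j` Taylor component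
`Q`. There `Q y` is a line coefficient, controlled by `|p x|`, while `|Q v| ≤ (2j)^j |Q y|`. -/
theorem abs_eval_homogeneousComponent_translatePoly_le {p : MvPolynomial (Fin k) ℝ} {q : ℕ}
    (hq : p.totalDegree ≤ q) {h : ℝ} (hh : 0 < h) {x : 𝔼 k} (hx : x ∉ nearZeroSet p h)
    {j : ℕ} (hj0 : j ≠ 0) (hjq : j ≤ q) (w : 𝔼 k) :
    |MvPolynomial.eval w.ofLp (MvPolynomial.homogeneousComponent j (translatePoly p x.ofLp))| ≤
      (2 * q ^ 2 / h * ‖w‖) ^ j * |MvPolynomial.eval x.ofLp p| := by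
  set P := translatePoly p x.ofLp with hP
  by_cases hw0 : w = 0
  · have := eval_smul_homogeneousComponent P j 0 w
    rw [zero_smul, zero_pow hj0, zero_mul, ← hw0] at this
    rw [this, abs_zero]
    positivity
  have hwp : 0 < ‖w‖ := norm_pos_iff.2 hw0
  set v := ‖w‖⁻¹ • w with hv
  have hv1 : ‖v‖ = 1 := by rw [hv, norm_smul, norm_inv, norm_norm, inv_mul_cancel₀ hwp.ne']
  have hwv : w = ‖w‖ • v := by rw [hv, smul_smul, mul_inv_cancel₀ hwp.ne', one_smul]
  set Q := MvPolynomial.homogeneousComponent j P with hQ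
  have hjpos : (0 : ℝ) < j := by exact_mod_cast Nat.pos_of_ne_zero hj0
  have hA := stdGaussian_abs_eval_lt_le (MvPolynomial.homogeneousComponent_isHomogeneous j P) hv1
    -- This `η` makes the exceptional measure at most `1/2`; the root condition fails with measure
    -- strictly below `1/2`, so the two bad sets cannot cover the space.
    (η := 1 / (2 * j)) (by positivity)
  rw [← hQ] at hA
  have hhalf : (j : ℝ≥0∞) * ENNReal.ofReal (1 / (2 * j)) = 2⁻¹ := by
    rw [← ENNReal.ofReal_natCast, ← ENNReal.ofReal_mul (by positivity)]
    rw [show (j : ℝ) * (1 / (2 * j)) = 2⁻¹ by field_simp]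
    rw [ENNReal.ofReal_inv_of_pos (by norm_num)]
    simp
  rw [hhalf] at hA
  have hB : stdGaussian (𝔼 k) (Prod.mk x ⁻¹' smallRootSet p h) < 2⁻¹ := not_le.1 hx
  obtain ⟨y, hy⟩ : ∃ y : 𝔼 k, y ∉ {y : 𝔼 k | |MvPolynomial.eval y.ofLp Q| <
      |MvPolynomial.eval v.ofLp Q| * (1 / (2 * j)) ^ j} ∪ Prod.mk x ⁻¹' smallRootSet p h := by
    by_contra! hall
    have huniv := Set.eq_univ_of_forall hall
    have := measure_union_le (μ := stdGaussian (𝔼 k)) {y : 𝔼 k | |MvPolynomial.eval y.ofLp Q| <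
      |MvPolynomial.eval v.ofLp Q| * (1 / (2 * j)) ^ j} (Prod.mk x ⁻¹' smallRootSet p h)
    rw [huniv, measure_univ] at this
    have h2 := ENNReal.add_lt_add_of_le_of_lt (ne_top_of_le_ne_top (by simp) hA) hA hB
    rw [ENNReal.inv_two_add_inv_two] at h2
    exact absurd (this.trans_lt h2) (lt_irrefl _)
  simp only [Set.mem_union, not_or, Set.mem_ofPred_eq, not_lt, Set.mem_preimage] at hy
  obtain ⟨hy1, hy2⟩ := hy
  have hroots : ∀ z : ℂ, ‖z‖ ≤ h → (lineRestriction P 0 y.ofLp).eval z ≠ 0 := by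
    intro z hz h0
    rw [hP, eval_lineRestriction_translatePoly] at h0
    exact hy2 ⟨z, hz, h0⟩
  have hcoef := norm_coeff_le_of_no_small_roots hh q _
    ((natDegree_lineRestriction_le P 0 y.ofLp).trans
      ((totalDegree_translatePoly_le p x.ofLp).trans hq)) hroots j
  have h0 : ‖(lineRestriction P 0 y.ofLp).coeff 0‖ = |MvPolynomial.eval x.ofLp p| := by
    have h1 : (lineRestriction P 0 y.ofLp).eval ((0 : ℝ) : ℂ) =
        (MvPolynomial.eval x.ofLp p : ℝ) := by
      rw [hP, eval_lineRestriction_translatePoly, eval_lineRestriction_point]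
      simp
    rw [Polynomial.coeff_zero_eq_eval_zero, ← Complex.ofReal_zero, h1, Complex.norm_real,
      Real.norm_eq_abs]
  rw [h0, coeff_lineRestriction_zero, Complex.norm_real, Real.norm_eq_abs] at hcoef
  have hchoose : (q.choose j : ℝ) ≤ (q : ℝ) ^ j := by exact_mod_cast Nat.choose_le_pow q j
  have hv2 : |MvPolynomial.eval v.ofLp Q| ≤
      (2 * q ^ 2 / h) ^ j * |MvPolynomial.eval x.ofLp p| := by
    have h3 : |MvPolynomial.eval v.ofLp Q| =
        (2 * j) ^ j * (|MvPolynomial.eval v.ofLp Q| * (1 / (2 * j)) ^ j) := by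
      rw [one_div, inv_pow]
      field_simp
    have hjq' : (j : ℝ) ≤ q := by exact_mod_cast hjq
    calc |MvPolynomial.eval v.ofLp Q|
        = (2 * j) ^ j * (|MvPolynomial.eval v.ofLp Q| * (1 / (2 * j)) ^ j) := h3
      _ ≤ (2 * q) ^ j * ((q : ℝ) ^ j * (h ^ j)⁻¹ * |MvPolynomial.eval x.ofLp p|) := by
          refine mul_le_mul (by gcongr) (hy1.trans (hcoef.trans ?_)) (by positivity) (by positivity)
          gcongr
      _ = (2 * q ^ 2 / h) ^ j * |MvPolynomial.eval x.ofLp p| := by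
          rw [div_pow, mul_pow, mul_pow, ← pow_mul]
          field_simp
          ring
  rw [hwv, hQ, eval_smul_homogeneousComponent, ← hQ, ← hwv, abs_mul, abs_pow, abs_norm, mul_pow]
  calc _ ≤ ‖w‖ ^ j * ((2 * q ^ 2 / h) ^ j * |MvPolynomial.eval x.ofLp p|) := by gcongr
    _ = _ := by ring

theorem abs_eval_add_sub_eval_lt {p : MvPolynomial (Fin k) ℝ} {q : ℕ} (hq1 : 1 ≤ q)
    (hq : p.totalDegree ≤ q) {ρ : ℝ} (hρ : 0 < ρ) {x : 𝔼 k}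
    (hx : x ∉ nearZeroSet p (8 * q ^ 2 * ρ)) {u : 𝔼 k} (hu : ‖u‖ ≤ ρ) :
    |MvPolynomial.eval (x + u).ofLp p - MvPolynomial.eval x.ofLp p| <
      |MvPolynomial.eval x.ofLp p| := by
  have hq0 : (0 : ℝ) < q := by exact_mod_cast hq1
  have hh : 0 < 8 * (q : ℝ) ^ 2 * ρ := by positivity
  set P := translatePoly p x.ofLp with hP
  have hdeg : P.totalDegree ≤ q := (totalDegree_translatePoly_le p x.ofLp).trans hq
  have hsum : ∀ y : 𝔼 k, MvPolynomial.eval (x + y).ofLp p =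
      MvPolynomial.eval x.ofLp p + ∑ j ∈ Finset.range q,
        MvPolynomial.eval y.ofLp (MvPolynomial.homogeneousComponent (j + 1) P) := by
    intro y
    have h1 : ∀ z : 𝔼 k, MvPolynomial.eval (x + z).ofLp p = ∑ j ∈ Finset.range (q + 1),
        MvPolynomial.eval z.ofLp (MvPolynomial.homogeneousComponent j P) := by
      intro z
      have h2 : MvPolynomial.eval (x + z).ofLp p = MvPolynomial.eval z.ofLp P := by
        rw [hP, eval_translatePoly]; rfl
      rw [h2, ← map_sum]
      congr 1
      conv_lhs => rw [← MvPolynomial.sum_homogeneousComponent P]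
      refine Finset.sum_subset (Finset.range_subset_range.2 (by omega)) fun j _ hj => ?_
      exact MvPolynomial.homogeneousComponent_eq_zero _ _ (by simpa using hj)
    have h0 := h1 0
    rw [add_zero, Finset.sum_range_succ'] at h0
    have hz : ∀ j, MvPolynomial.eval (0 : 𝔼 k).ofLp
        (MvPolynomial.homogeneousComponent (j + 1) P) = 0 := by
      intro j
      have := eval_smul_homogeneousComponent P (j + 1) 0 0
      simpa using this
    rw [Finset.sum_eq_zero fun j _ => hz j, zero_add] at h0
    rw [h1 y, Finset.sum_range_succ', h0, add_comm]
    congr 1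
    simp [MvPolynomial.homogeneousComponent_zero]
  have hpx : 0 < |MvPolynomial.eval x.ofLp p| := by
    rw [abs_pos]
    -- If `p x = 0`, then `t = 0` is a root in every direction, so `x` would belong to the near-zero
    -- set.
    intro h0
    apply hx
    have : (Prod.mk x ⁻¹' smallRootSet p (8 * q ^ 2 * ρ)) = Set.univ := by
      refine Set.eq_univ_of_forall fun y => ⟨(0 : ℝ), by simpa using hh.le, ?_⟩
      rw [eval_lineRestriction_point]
      simp [h0]
    simp [nearZeroSet, this]
  rw [hsum u, add_sub_cancel_left]
  have hterm : ∀ j ∈ Finset.range q,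
      |MvPolynomial.eval u.ofLp (MvPolynomial.homogeneousComponent (j + 1) P)| ≤
        (1 / 4 : ℝ) ^ (j + 1) * |MvPolynomial.eval x.ofLp p| := by
    intro j hj
    refine (abs_eval_homogeneousComponent_translatePoly_le hq hh hx (Nat.succ_ne_zero j)
      (Finset.mem_range.1 hj) u).trans ?_
    -- The radius `h = 8 q² ρ` turns the ratio `2 q² ‖u‖ / h` into at most `1/4`; the geometric sum
    -- then stays below `1/3`.
    gcongr
    calc 2 * (q : ℝ) ^ 2 / (8 * q ^ 2 * ρ) * ‖u‖ ≤ 2 * (q : ℝ) ^ 2 / (8 * q ^ 2 * ρ) * ρ := by gcongr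
      _ = 1 / 4 := by field_simp; norm_num
  have hgeo : ∀ m : ℕ, ∑ j ∈ Finset.range m, (1 / 4 : ℝ) ^ (j + 1) = (1 - (1 / 4) ^ m) / 3 := by
    intro m
    induction m with
    | zero => simp
    | succ m ih => rw [Finset.sum_range_succ, ih]; ring
  calc _ ≤ ∑ j ∈ Finset.range q, (1 / 4 : ℝ) ^ (j + 1) * |MvPolynomial.eval x.ofLp p| :=
        (Finset.abs_sum_le_sum_abs _ _).trans (Finset.sum_le_sum hterm)
    _ = (1 - (1 / 4) ^ q) / 3 * |MvPolynomial.eval x.ofLp p| := by rw [← Finset.sum_mul, hgeo]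
    _ < 1 * |MvPolynomial.eval x.ofLp p| := by
        apply mul_lt_mul_of_pos_right _ hpx
        have : (0 : ℝ) < (1 / 4) ^ q := by positivity
        linarith
    _ = _ := one_mul _

/-- Gaussian measure of a neighborhood of the boundary of a polynomial threshold function. -/
theorem IsPTF.exists_stable_off_small_set {q : ℕ} (hq1 : 1 ≤ q) {f : (𝔼 k) → ℝ} (hf : IsPTF q f)
    {ρ : ℝ} (hρ : 0 < ρ) :
    ∃ G : Set (𝔼 k), MeasurableSet G ∧
      stdGaussian (𝔼 k) G ≤ ENNReal.ofReal (16 * q ^ 3 * k * ρ) ∧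
      ∀ x ∉ G, ∀ z, ‖z - x‖ ≤ ρ → f z = f x := by
  obtain ⟨p, hdeg, hpos, hneg⟩ := hf
  by_cases hp : p = 0
  · refine ⟨∅, MeasurableSet.empty, by simp, fun x _ z _ => ?_⟩
    rw [hpos x (by simp [hp]), hpos z (by simp [hp])]
  refine ⟨nearZeroSet p (8 * q ^ 2 * ρ), measurableSet_nearZeroSet _ _, ?_, fun x hx z hz => ?_⟩
  · refine (stdGaussian_nearZeroSet_le hp hdeg _).trans_eq ?_
    congr 1; ring
  · have h := abs_eval_add_sub_eval_lt hq1 hdeg hρ hx hz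
    rw [add_sub_cancel] at h
    rcases lt_or_ge (MvPolynomial.eval x.ofLp p) 0 with h0 | h0
    · rw [abs_of_neg h0, abs_lt] at h
      rw [hneg x h0, hneg z (by linarith)]
    · rw [abs_of_nonneg h0, abs_lt] at h
      rw [hpos x h0, hpos z (by linarith)]

end Tube

/-! ### A positive polynomial kernel on `[-1, 1]` -/

section Kernel

open Polynomial Finset

/-- The equally spaced angle `2πm/N`. -/
noncomputable def nodeAngle (N m : ℕ) : ℝ := 2 * Real.pi * m / N

/-- Real part of the geometric sum of the powers of a nontrivial `N`-th root of unity. -/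
theorem sum_cos_nodeAngle {N : ℕ} (hN : 0 < N) {r : ℤ} (hr : |r| < N) :
    ∑ m ∈ range N, Real.cos (r * nodeAngle N m) = if r = 0 then (N : ℝ) else 0 := by
  split_ifs with h0
  · simp [h0]
  have hζ := Complex.isPrimitiveRoot_exp N hN.ne'
  set ζ := Complex.exp (2 * Real.pi * Complex.I / N) with hζdef
  have hnat : ∑ m ∈ range N, Real.cos (r * nodeAngle N m) =
      ∑ m ∈ range N, Real.cos (r.natAbs * nodeAngle N m) := by
    refine sum_congr rfl fun m _ => ?_
    rw [Nat.cast_natAbs]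
    rcases abs_choice r with h | h <;> rw [h]
    push_cast
    rw [neg_mul, Real.cos_neg]
  rw [hnat]
  set s := r.natAbs with hs
  have hs0 : s ≠ 0 := by omega
  have hsN : s < N := by rw [abs_lt] at hr; omega
  have hne : ζ ^ s ≠ 1 := hζ.pow_ne_one_of_pos_of_lt hs0 hsN
  have hpow : (ζ ^ s) ^ N = 1 := by rw [← pow_mul, mul_comm, pow_mul, hζ.pow_eq_one, one_pow]
  have hgeom : ∑ m ∈ range N, (ζ ^ s) ^ m = 0 := by
    have := mul_geom_sum (ζ ^ s) N
    rw [hpow, sub_self] at this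
    exact (mul_eq_zero.1 this).resolve_left (sub_ne_zero.2 hne)
  have hre : ∀ m, Real.cos (s * nodeAngle N m) = ((ζ ^ s) ^ m).re := by
    intro m
    rw [← pow_mul, hζdef, ← Complex.exp_nat_mul]
    rw [show ((s * m : ℕ) : ℂ) * (2 * Real.pi * Complex.I / N) =
      ((s * nodeAngle N m : ℝ) : ℂ) * Complex.I by unfold nodeAngle; push_cast; ring]
    rw [Complex.exp_ofReal_mul_I_re]
  simp_rw [hre]
  rw [← Complex.re_sum, hgeom, Complex.zero_re]

/-- Weight polynomials of the positive operator on `[-1, 1]` given by the trigonometric kernel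
`|∑ a_j e^{ijθ}|²`, discretized at `N` equally spaced angles. -/
noncomputable def kernelWeight (a : ℕ → ℝ) (n N m : ℕ) : ℝ[X] :=
  C (1 / (N * ∑ j ∈ range n, a j ^ 2)) * ∑ j ∈ range n, ∑ l ∈ range n,
    C (a j * a l * Real.cos (((j : ℤ) - l : ℤ) * nodeAngle N m)) * Chebyshev.T ℝ ((j : ℤ) - l)

theorem eval_kernelWeight (a : ℕ → ℝ) (n N m : ℕ) (t : ℝ) :
    (kernelWeight a n N m).eval t = 1 / (N * ∑ j ∈ range n, a j ^ 2) *
      ∑ j ∈ range n, ∑ l ∈ range n, a j * a l * Real.cos (((j : ℤ) - l : ℤ) * nodeAngle N m) *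
        (Chebyshev.T ℝ ((j : ℤ) - l)).eval t := by
  simp only [kernelWeight, eval_mul, eval_C, eval_finsetSum]

theorem natDegree_kernelWeight_le (a : ℕ → ℝ) (n N m : ℕ) :
    (kernelWeight a n N m).natDegree ≤ n := by
  refine (natDegree_C_mul_le _ _).trans ?_
  refine natDegree_sum_le_of_forall_le _ _ fun j hj => ?_
  refine natDegree_sum_le_of_forall_le _ _ fun l hl => ?_
  refine (natDegree_C_mul_le _ _).trans ?_
  rw [Chebyshev.natDegree_T]
  have := mem_range.1 hj
  have := mem_range.1 hl
  omega

/-- With `t = cos θ` and node `φ`, the double sum is the average of the squared moduli of `∑ a_j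
e^{ijψ}` at `ψ = θ - φ` and `ψ = θ + φ`. -/
theorem kernelWeight_eval_nonneg (a : ℕ → ℝ) (n N m : ℕ) {t : ℝ} (ht : |t| ≤ 1) :
    0 ≤ (kernelWeight a n N m).eval t := by
  rw [eval_kernelWeight]
  refine mul_nonneg (by positivity) ?_
  obtain ⟨h1, h2⟩ := abs_le.1 ht
  set θ := Real.arccos t with hθ
  set φ := nodeAngle N m
  have ht' : t = Real.cos θ := (Real.cos_arccos h1 h2).symm
  have hpos : ∀ ψ : ℝ, ∑ j ∈ range n, ∑ l ∈ range n,
      a j * a l * Real.cos (((j : ℤ) - l : ℤ) * ψ) =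
        (∑ j ∈ range n, a j * Real.cos (j * ψ)) ^ 2 +
          (∑ j ∈ range n, a j * Real.sin (j * ψ)) ^ 2 := by
    intro ψ
    rw [sq, sq, sum_mul_sum, sum_mul_sum, ← sum_add_distrib]
    refine sum_congr rfl fun j _ => ?_
    rw [← sum_add_distrib]
    refine sum_congr rfl fun l _ => ?_
    push_cast
    rw [sub_mul, Real.cos_sub]
    ring
  have hsum : ∑ j ∈ range n, ∑ l ∈ range n, a j * a l * Real.cos (((j : ℤ) - l : ℤ) * φ) *
        (Chebyshev.T ℝ ((j : ℤ) - l)).eval t =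
      (∑ j ∈ range n, ∑ l ∈ range n, a j * a l * Real.cos (((j : ℤ) - l : ℤ) * (θ - φ)) +
        ∑ j ∈ range n, ∑ l ∈ range n, a j * a l * Real.cos (((j : ℤ) - l : ℤ) * (θ + φ))) / 2 := by
    rw [← sum_add_distrib, sum_div]
    refine sum_congr rfl fun j _ => ?_
    rw [← sum_add_distrib, sum_div]
    refine sum_congr rfl fun l _ => ?_
    rw [ht', Chebyshev.T_real_cos, mul_sub, mul_add, Real.cos_sub, Real.cos_add]
    ring
  rw [hsum, hpos, hpos]
  positivity

/-- The operator is diagonal on low-degree Chebyshev polynomials, with eigenvalue the normalized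
autocorrelation of `a` at lag `s`. Discretization is exact because `n + s ≤ N` keeps all frequencies
`j - l ± s` below `N` in absolute value. -/
theorem sum_kernelWeight_mul_cos (a : ℕ → ℝ) {n N s : ℕ} (hs : n + s ≤ N) (hN : 0 < N) (t : ℝ) :
    ∑ m ∈ range N, (kernelWeight a n N m).eval t * Real.cos (s * nodeAngle N m) =
      (∑ l ∈ range n, if l + s < n then a (l + s) * a l else 0) / (∑ j ∈ range n, a j ^ 2) *
        (Chebyshev.T ℝ s).eval t := by
  have hcos : ∀ j ∈ range n, ∀ l ∈ range n,
      ∑ m ∈ range N, Real.cos (((j : ℤ) - l : ℤ) * nodeAngle N m) * Real.cos (s * nodeAngle N m) =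
        ((if j = l + s then (N : ℝ) else 0) + (if l = j + s then (N : ℝ) else 0)) / 2 := by
    intro j hj l hl
    have hj := mem_range.1 hj
    have hl := mem_range.1 hl
    have h1 := sum_cos_nodeAngle hN (r := (j : ℤ) - l - s) (by rw [abs_lt]; omega)
    have h2 := sum_cos_nodeAngle hN (r := (j : ℤ) - l + s) (by rw [abs_lt]; omega)
    have e1 : ((j : ℤ) - l - s = 0) ↔ j = l + s := by omega
    have e2 : ((j : ℤ) - l + s = 0) ↔ l = j + s := by omega
    simp only [e1] at h1
    simp only [e2] at h2
    rw [← h1, ← h2, ← sum_add_distrib, sum_div]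
    refine sum_congr rfl fun m _ => ?_
    push_cast
    rw [sub_mul _ (s : ℝ), add_mul _ (s : ℝ), Real.cos_sub, Real.cos_add]
    ring
  have hN' : (N : ℝ) ≠ 0 := by exact_mod_cast hN.ne'
  have hswap : ∑ m ∈ range N, (kernelWeight a n N m).eval t * Real.cos (s * nodeAngle N m) =
      1 / (N * ∑ j ∈ range n, a j ^ 2) * ∑ j ∈ range n, ∑ l ∈ range n, a j * a l *
        (Chebyshev.T ℝ ((j : ℤ) - l)).eval t *
          (((if j = l + s then (N : ℝ) else 0) + (if l = j + s then (N : ℝ) else 0)) / 2) := by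
    simp_rw [eval_kernelWeight, mul_assoc (1 / ((N : ℝ) * ∑ j ∈ range n, a j ^ 2)), ← mul_sum,
      sum_mul]
    congr 1
    rw [sum_comm]
    refine sum_congr rfl fun j hj => ?_
    rw [sum_comm]
    refine sum_congr rfl fun l hl => ?_
    rw [← hcos j hj l hl, mul_sum]
    refine sum_congr rfl fun m _ => ?_
    ring
  have hB1 : ∑ j ∈ range n, ∑ l ∈ range n, (if l = j + s then a j * a l *
      (Chebyshev.T ℝ ((j : ℤ) - l)).eval t else 0) =
      (∑ l ∈ range n, if l + s < n then a (l + s) * a l else 0) * (Chebyshev.T ℝ s).eval t := by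
    rw [sum_mul]
    refine sum_congr rfl fun j _ => ?_
    rw [sum_ite_eq']
    simp only [mem_range]
    split_ifs
    · push_cast
      rw [show (j : ℤ) - (j + s) = -s by ring, Chebyshev.T_neg]
      ring
    · ring
  have hB2 : ∑ j ∈ range n, ∑ l ∈ range n, (if j = l + s then a j * a l *
      (Chebyshev.T ℝ ((j : ℤ) - l)).eval t else 0) =
      (∑ l ∈ range n, if l + s < n then a (l + s) * a l else 0) * (Chebyshev.T ℝ s).eval t := by
    rw [sum_comm, ← hB1]
    refine sum_congr rfl fun l _ => sum_congr rfl fun j _ => ?_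
    rw [← Chebyshev.T_neg, neg_sub, mul_comm (a j)]
  rw [hswap]
  have hsplit : ∑ j ∈ range n, ∑ l ∈ range n, a j * a l *
        (Chebyshev.T ℝ ((j : ℤ) - l)).eval t *
          (((if j = l + s then (N : ℝ) else 0) + (if l = j + s then (N : ℝ) else 0)) / 2) =
      N / 2 * (∑ j ∈ range n, ∑ l ∈ range n, (if j = l + s then a j * a l *
          (Chebyshev.T ℝ ((j : ℤ) - l)).eval t else 0) +
        ∑ j ∈ range n, ∑ l ∈ range n, (if l = j + s then a j * a l *
          (Chebyshev.T ℝ ((j : ℤ) - l)).eval t else 0)) := by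
    rw [← sum_add_distrib, mul_sum]
    refine sum_congr rfl fun j _ => ?_
    rw [← sum_add_distrib, mul_sum]
    refine sum_congr rfl fun l _ => ?_
    split_ifs <;> ring
  rw [hsplit, hB1, hB2]
  by_cases hA : ∑ j ∈ range n, a j ^ 2 = 0
  · simp [hA]
  · field_simp
    ring

theorem abs_eval_chebyshevT_le (r : ℤ) (t : ℝ) :
    |(Chebyshev.T ℝ r).eval t| ≤ (1 + 2 * |t|) ^ r.natAbs := by
  have hnat : ∀ r : ℕ, |(Chebyshev.T ℝ r).eval t| ≤ (1 + 2 * |t|) ^ r ∧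
      |(Chebyshev.T ℝ (r + 1 : ℕ)).eval t| ≤ (1 + 2 * |t|) ^ (r + 1) := by
    intro r
    induction r with
    | zero =>
      have := abs_nonneg t
      simp
      linarith
    | succ r ih =>
      refine ⟨ih.2, ?_⟩
      have h2 : (Chebyshev.T ℝ (r + 1 + 1 : ℕ)).eval t =
          2 * t * (Chebyshev.T ℝ (r + 1 : ℕ)).eval t - (Chebyshev.T ℝ r).eval t := by
        have := congrArg (eval t) (Chebyshev.T_add_two ℝ r)
        simp only [eval_sub, eval_mul, eval_ofNat, eval_X] at this
        push_cast
        rw [← this, add_assoc]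
        norm_num
      have ht := abs_nonneg t
      rw [h2]
      calc _ ≤ |2 * t * (Chebyshev.T ℝ (r + 1 : ℕ)).eval t| + |(Chebyshev.T ℝ r).eval t| :=
            abs_sub _ _
        _ ≤ 2 * |t| * (1 + 2 * |t|) ^ (r + 1) + (1 + 2 * |t|) ^ r := by
            rw [abs_mul, abs_mul, abs_two]
            gcongr
            · exact ih.2
            · exact ih.1
        _ ≤ (1 + 2 * |t|) ^ (r + 1 + 1) := by
            have hp : 0 ≤ (1 + 2 * |t|) ^ r := by positivity
            rw [pow_succ _ (r + 1), pow_succ _ r]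
            nlinarith [mul_nonneg hp ht]
  have := (hnat r.natAbs).1
  rwa [Chebyshev.T_natAbs] at this

/-- Growth control valid also outside `[-1, 1]`, where positivity fails: Cauchy–Schwarz gives `(∑
|a_j|)² ≤ n ∑ a_j²`. -/
theorem sum_abs_eval_kernelWeight_le (a : ℕ → ℝ) (n N : ℕ) (t : ℝ) :
    ∑ m ∈ range N, |(kernelWeight a n N m).eval t| ≤ n * (1 + 2 * |t|) ^ n := by
  have ht := abs_nonneg t
  set A := ∑ j ∈ range n, a j ^ 2 with hAdef
  have hA0 : 0 ≤ A := sum_nonneg fun j _ => sq_nonneg _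
  have hterm : ∀ m ∈ range N, |(kernelWeight a n N m).eval t| ≤
      1 / (N * A) * ((∑ j ∈ range n, |a j|) ^ 2 * (1 + 2 * |t|) ^ n) := by
    intro m _
    rw [eval_kernelWeight, abs_mul, abs_of_nonneg (by positivity : 0 ≤ 1 / (N * A))]
    gcongr
    refine (abs_sum_le_sum_abs _ _).trans ?_
    rw [sq, sum_mul_sum, sum_mul]
    refine sum_le_sum fun j hj => (abs_sum_le_sum_abs _ _).trans ?_
    rw [sum_mul]
    refine sum_le_sum fun l hl => ?_
    rw [abs_mul, abs_mul, abs_mul]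
    have h1 : |(Chebyshev.T ℝ ((j : ℤ) - l)).eval t| ≤ (1 + 2 * |t|) ^ n := by
      refine (abs_eval_chebyshevT_le _ t).trans (pow_le_pow_right₀ (by linarith) ?_)
      have := mem_range.1 hj
      have := mem_range.1 hl
      omega
    have h2 := Real.abs_cos_le_one (((j : ℤ) - l : ℤ) * nodeAngle N m)
    calc _ ≤ |a j| * |a l| * 1 * (1 + 2 * |t|) ^ n := by gcongr
      _ = _ := by ring
  have hCS : (∑ j ∈ range n, |a j|) ^ 2 ≤ n * A := by
    have := sq_sum_le_card_mul_sum_sq (s := range n) (f := fun j => |a j|)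
    simpa [sq_abs] using this
  refine (sum_le_sum hterm).trans ?_
  rw [sum_const, card_range, nsmul_eq_mul]
  rcases Nat.eq_zero_or_pos N with rfl | hN
  · simp; positivity
  rcases hA0.eq_or_lt with h0 | hApos
  · rw [← h0]; simp; positivity
  have hN' : (0 : ℝ) < N := by exact_mod_cast hN
  calc _ ≤ N * (1 / (N * A) * (n * A * (1 + 2 * |t|) ^ n)) := by gcongr
    _ = _ := by field_simp

/-- The coefficients `j (n - j)`. -/
def jacksonCoeff (n j : ℕ) : ℝ := j * ((n : ℝ) - j)

theorem sum_range_powers (M : ℕ) :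
    ∑ j ∈ range M, (j : ℝ) = M * (M - 1) / 2 ∧
    ∑ j ∈ range M, (j : ℝ) ^ 2 = M * (M - 1) * (2 * M - 1) / 6 ∧
    ∑ j ∈ range M, (j : ℝ) ^ 3 = M ^ 2 * (M - 1) ^ 2 / 4 ∧
    ∑ j ∈ range M, (j : ℝ) ^ 4 = M * (M - 1) * (2 * M - 1) * (3 * M ^ 2 - 3 * M - 1) / 30 := by
  induction M with
  | zero => simp
  | succ M ih =>
    obtain ⟨h1, h2, h3, h4⟩ := ih
    simp only [sum_range_succ, h1, h2, h3, h4]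
    push_cast
    refine ⟨?_, ?_, ?_, ?_⟩ <;> ring

theorem sum_jacksonCoeff_mul_shift (n : ℕ) (s : ℝ) :
    ∑ j ∈ range n, ((j + s) * ((n : ℝ) - (j + s))) * jacksonCoeff n j =
      (s * n - s ^ 2) * (n * (n * (n - 1) / 2) - n * (n - 1) * (2 * n - 1) / 6) +
      (n - 2 * s) * (n * (n * (n - 1) * (2 * n - 1) / 6) - n ^ 2 * (n - 1) ^ 2 / 4) -
      (n * (n ^ 2 * (n - 1) ^ 2 / 4) -
        n * (n - 1) * (2 * n - 1) * (3 * n ^ 2 - 3 * n - 1) / 30) := by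
  obtain ⟨h1, h2, h3, h4⟩ := sum_range_powers n
  rw [← h1, ← h2, ← h3, ← h4]
  simp only [mul_sum, ← sum_sub_distrib, ← sum_add_distrib, jacksonCoeff]
  refine sum_congr rfl fun j _ => ?_
  ring

/-- The parabola `j (n - j)` vanishes at both ends, which makes the normalized autocorrelations at
lags 1 and 2 differ from 1 by only `O(1/n²)`. -/
theorem jacksonCoeff_moments {n : ℕ} (hn : 2 ≤ n) :
    ∑ j ∈ range n, jacksonCoeff n j ^ 2 = n * ((n : ℝ) ^ 4 - 1) / 30 ∧
    (∑ l ∈ range n, if l + 1 < n then jacksonCoeff n (l + 1) * jacksonCoeff n l else 0) =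
      n * ((n : ℝ) ^ 4 - 1) / 30 - n * ((n : ℝ) ^ 2 - 1) / 6 ∧
    (∑ l ∈ range n, if l + 2 < n then jacksonCoeff n (l + 2) * jacksonCoeff n l else 0) =
      n * ((n : ℝ) ^ 4 - 1) / 30 - ((n : ℝ) ^ 2 - 1) * (2 * n - 3) / 3 := by
  refine ⟨?_, ?_, ?_⟩
  · have := sum_jacksonCoeff_mul_shift n 0
    simp only [add_zero] at this
    calc _ = _ := sum_congr rfl fun j _ => by rw [sq]; rfl
      _ = _ := this
      _ = _ := by ring
  · have := sum_jacksonCoeff_mul_shift n 1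
    calc _ = ∑ j ∈ range n, (((j : ℝ) + 1) * ((n : ℝ) - (j + 1))) * jacksonCoeff n j := by
          refine sum_congr rfl fun j hj => ?_
          split_ifs with h
          · simp [jacksonCoeff]
          · have : j + 1 = n := by have := mem_range.1 hj; omega
            rw [← this]; simp
      _ = _ := this
      _ = _ := by ring
  · obtain ⟨M, rfl⟩ : ∃ M, n = M + 2 := ⟨n - 2, by omega⟩
    have := sum_jacksonCoeff_mul_shift (M + 2) 2
    -- The unrestricted shifted sum has one spurious nonzero term, at `j = n - 1`, equal to `-(n² -
    -- 1)`; the term at `j = n - 2` vanishes.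
    have hlast : ∑ l ∈ range (M + 2), (if l + 2 < M + 2 then
        jacksonCoeff (M + 2) (l + 2) * jacksonCoeff (M + 2) l else 0) =
        ∑ j ∈ range (M + 2), (((j : ℝ) + 2) * (((M + 2 : ℕ) : ℝ) - (j + 2))) *
          jacksonCoeff (M + 2) j + (((M + 2 : ℕ) : ℝ) ^ 2 - 1) := by
      rw [sum_range_succ, sum_range_succ, sum_range_succ _ (M + 1), sum_range_succ _ M]
      rw [sum_congr rfl fun l hl => if_pos (by have := mem_range.1 hl; omega)]
      rw [if_neg (by omega), if_neg (by omega)]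
      simp only [jacksonCoeff]
      push_cast
      ring
    rw [hlast, this]
    push_cast
    ring

/-- A positive polynomial operator on `[-1, 1]` with second moment `O(1/n²)`. -/
theorem exists_jackson_weights {n : ℕ} (hn : 2 ≤ n) :
    ∃ (N : ℕ) (c : Fin N → ℝ) (w : Fin N → ℝ[X]), (∀ m, |c m| ≤ 1) ∧
      (∀ m, (w m).natDegree ≤ n) ∧ (∀ m t, |t| ≤ 1 → 0 ≤ (w m).eval t) ∧
      (∀ t, ∑ m, (w m).eval t = 1) ∧
      (∀ t, |t| ≤ 1 → ∑ m, (w m).eval t * (c m - t) ^ 2 ≤ 20 / (n : ℝ) ^ 2) ∧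
      ∀ t, ∑ m, |(w m).eval t| ≤ n * (1 + 2 * |t|) ^ n := by
  set a := jacksonCoeff n with ha
  -- The second moment involves lags up to 2, and this is the least `N` allowed for them.
  set N := n + 2 with hNdef
  have hN : 0 < N := by omega
  obtain ⟨hA, hB1, hB2⟩ := jacksonCoeff_moments hn
  rw [← ha] at hA hB1 hB2
  have hn2 : (2 : ℝ) ≤ n := by exact_mod_cast hn
  have hn4 : (0 : ℝ) < (n : ℝ) ^ 4 - 1 := by nlinarith [sq_nonneg ((n : ℝ) ^ 2 - 4), sq_nonneg (n : ℝ)]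
  have hApos : (0 : ℝ) < n * ((n : ℝ) ^ 4 - 1) / 30 := by positivity
  have m0 : ∀ t, ∑ m ∈ range N, (kernelWeight a n N m).eval t = 1 := by
    intro t
    have := sum_kernelWeight_mul_cos a (n := n) (N := N) (s := 0) (by omega) hN t
    simp only [Nat.cast_zero, zero_mul, Real.cos_zero, mul_one, add_zero, Chebyshev.T_zero,
      eval_one] at this
    rw [this, sum_congr rfl fun l hl => if_pos (mem_range.1 hl)]
    simp only [← sq]
    rw [hA, div_self hApos.ne']
  refine ⟨N, fun m => Real.cos (nodeAngle N m), fun m => kernelWeight a n N m,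
    fun m => Real.abs_cos_le_one _, fun m => natDegree_kernelWeight_le a n N m,
    fun m t ht => kernelWeight_eval_nonneg a n N m ht, fun t => ?_, fun t ht => ?_, fun t => ?_⟩
  · rw [Fin.sum_univ_eq_sum_range (fun m => (kernelWeight a n N m).eval t), m0]
  · rw [Fin.sum_univ_eq_sum_range
      (fun m => (kernelWeight a n N m).eval t * (Real.cos (nodeAngle N m) - t) ^ 2)]
    have m1 := sum_kernelWeight_mul_cos a (n := n) (N := N) (s := 1) (by omega) hN t
    have m2 := sum_kernelWeight_mul_cos a (n := n) (N := N) (s := 2) (by omega) hN t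
    rw [hA, hB1] at m1
    rw [hA, hB2] at m2
    simp only [Nat.cast_one, one_mul, Chebyshev.T_one, eval_X, Nat.cast_ofNat] at m1 m2
    rw [Chebyshev.T_two] at m2
    simp only [eval_sub, eval_mul, eval_pow, eval_X, eval_one, eval_ofNat] at m2
    -- Writing `cos² = (1 + cos 2φ)/2` expresses the second moment through the eigenvalues at lags
    -- 0, 1 and 2.
    have hexp : ∑ m ∈ range N, (kernelWeight a n N m).eval t * (Real.cos (nodeAngle N m) - t) ^ 2 =
        (1 / 2 + t ^ 2) * ∑ m ∈ range N, (kernelWeight a n N m).eval t +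
        1 / 2 * ∑ m ∈ range N, (kernelWeight a n N m).eval t * Real.cos (2 * nodeAngle N m) -
        2 * t * ∑ m ∈ range N, (kernelWeight a n N m).eval t * Real.cos (nodeAngle N m) := by
      rw [mul_sum, mul_sum, mul_sum, ← sum_add_distrib, ← sum_sub_distrib]
      refine sum_congr rfl fun m _ => ?_
      rw [Real.cos_two_mul]
      ring
    rw [hexp, m0, m1, m2]
    have ht2 : t ^ 2 ≤ 1 := by rw [← sq_abs]; exact pow_le_one₀ (abs_nonneg t) ht
    have ht0 := sq_nonneg t
    have hn0 : (0 : ℝ) < n := by linarith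
    have e1 : (n * ((n : ℝ) ^ 4 - 1) / 30 - n * ((n : ℝ) ^ 2 - 1) / 6) /
        (n * ((n : ℝ) ^ 4 - 1) / 30) = 1 - 5 / ((n : ℝ) ^ 2 + 1) := by
      have : (n : ℝ) ^ 4 - 1 = ((n : ℝ) ^ 2 - 1) * (n ^ 2 + 1) := by ring
      have h1 : (n : ℝ) ^ 2 - 1 ≠ 0 := by nlinarith
      rw [this]
      field_simp
      ring
    have e2 : (n * ((n : ℝ) ^ 4 - 1) / 30 - ((n : ℝ) ^ 2 - 1) * (2 * n - 3) / 3) /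
        (n * ((n : ℝ) ^ 4 - 1) / 30) = 1 - 10 * (2 * n - 3) / (n * ((n : ℝ) ^ 2 + 1)) := by
      have : (n : ℝ) ^ 4 - 1 = ((n : ℝ) ^ 2 - 1) * (n ^ 2 + 1) := by ring
      have h1 : (n : ℝ) ^ 2 - 1 ≠ 0 := by nlinarith
      rw [this]
      field_simp
      ring
    rw [e1, e2]
    set α := 5 / ((n : ℝ) ^ 2 + 1) with hα
    set β := 10 * (2 * n - 3) / (n * ((n : ℝ) ^ 2 + 1)) with hβ
    have hβ0 : 0 ≤ β := by
      apply div_nonneg <;> nlinarith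
    have hα0 : 0 ≤ α := by positivity
    have hβα : β ≤ 4 * α := by
      rw [hβ, hα, mul_div_assoc', div_le_div_iff₀ (by positivity) (by positivity)]
      nlinarith [sq_nonneg (n : ℝ)]
    have hα2 : 4 * α ≤ 20 / (n : ℝ) ^ 2 := by
      rw [hα, mul_div_assoc']
      norm_num
      gcongr
      linarith
    have : (1 / 2 + t ^ 2) * 1 + 1 / 2 * ((1 - β) * (2 * t ^ 2 - 1)) - 2 * t * ((1 - α) * t) =
        β / 2 + t ^ 2 * (2 * α - β) := by ring
    rw [this]
    nlinarith [mul_nonneg hα0 (sub_nonneg.2 ht2), mul_nonneg hβ0 ht0]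
  · rw [Fin.sum_univ_eq_sum_range (fun m => |(kernelWeight a n N m).eval t|)]
    exact sum_abs_eval_kernelWeight_le a n N t

end Kernel

/-! ### Polynomial approximation on a cube and Lipschitz majorants -/

section Approximation

variable {k : ℕ}

local notation "𝔼" k => EuclideanSpace ℝ (Fin k)

theorem totalDegree_aeval_le_natDegree (w : Polynomial ℝ) {Y : MvPolynomial (Fin k) ℝ}
    (hY : Y.totalDegree ≤ 1) : (Polynomial.aeval Y w).totalDegree ≤ w.natDegree := by
  rw [Polynomial.aeval_eq_sum_range]
  refine MvPolynomial.totalDegree_finsetSum_le fun j hj => ?_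
  refine (MvPolynomial.totalDegree_smul_le _ _).trans
    ((MvPolynomial.totalDegree_pow _ _).trans ?_)
  have := Finset.mem_range.1 hj
  calc j * Y.totalDegree ≤ j * 1 := Nat.mul_le_mul_left _ hY
    _ ≤ w.natDegree := by omega

theorem eval_aeval_polynomial (w : Polynomial ℝ) (Y : MvPolynomial (Fin k) ℝ) (x : Fin k → ℝ) :
    MvPolynomial.eval x (Polynomial.aeval Y w) = w.eval (MvPolynomial.eval x Y) := by
  rw [Polynomial.aeval_eq_sum_range, Polynomial.eval_eq_sum_range, map_sum]
  refine Finset.sum_congr rfl fun j _ => ?_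
  rw [MvPolynomial.smul_eval, map_pow]

/-- Tensor-product Jackson approximation of a Lipschitz function on a cube. -/
theorem exists_mvPolynomial_approx {n : ℕ} (hn : 2 ≤ n) {Φ : (𝔼 k) → ℝ} {L R : ℝ} (hL : 0 ≤ L)
    (hR : 0 < R) (hLip : ∀ x y, |Φ x - Φ y| ≤ L * ‖x - y‖) (hΦ : ∀ x, |Φ x| ≤ 1) :
    ∃ P : MvPolynomial (Fin k) ℝ, P.totalDegree ≤ k * n ∧
      (∀ x : 𝔼 k, (∀ i, |x.ofLp i| ≤ R) →
        |MvPolynomial.eval x.ofLp P - Φ x| ≤ 5 * L * R * √k / n) ∧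
      ∀ x : 𝔼 k, |MvPolynomial.eval x.ofLp P| ≤ (n * (1 + 2 * (‖x‖ / R)) ^ n) ^ k := by
  classical
  obtain ⟨N, c, w, hc, hdeg, hpos, hsum, hmom, habs⟩ := exists_jackson_weights hn
  have hn0 : (0 : ℝ) < n := by
    have : (2 : ℝ) ≤ n := by exact_mod_cast hn
    linarith
  let node : (Fin k → Fin N) → 𝔼 k := fun m => WithLp.toLp 2 fun i => R * c (m i)
  let P : MvPolynomial (Fin k) ℝ := ∑ m : Fin k → Fin N, MvPolynomial.C (Φ (node m)) *
    ∏ i, Polynomial.aeval (MvPolynomial.C (1 / R) * MvPolynomial.X i) (w (m i))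
  have heval : ∀ x : 𝔼 k, MvPolynomial.eval x.ofLp P =
      ∑ m : Fin k → Fin N, Φ (node m) * ∏ i, (w (m i)).eval (x.ofLp i / R) := by
    intro x
    simp only [P, map_sum, map_mul, map_prod, MvPolynomial.eval_C, eval_aeval_polynomial,
      MvPolynomial.eval_X, one_div, inv_mul_eq_div]
  have hprod : ∀ g : Fin k → Fin N → ℝ,
      ∑ m : Fin k → Fin N, ∏ i, g i (m i) = ∏ i, ∑ j, g i j := by
    intro g
    rw [Finset.prod_univ_sum, Fintype.piFinset_univ]
  refine ⟨P, ?_, fun x hx => ?_, fun x => ?_⟩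
  · refine MvPolynomial.totalDegree_finsetSum_le fun m _ => ?_
    refine (MvPolynomial.totalDegree_mul _ _).trans ?_
    rw [MvPolynomial.totalDegree_C, zero_add]
    refine (MvPolynomial.totalDegree_finsetProd _ _).trans ?_
    refine (Finset.sum_le_sum (g := fun _ => n) fun i _ => ?_).trans (by simp)
    refine (totalDegree_aeval_le_natDegree _ ?_).trans (hdeg (m i))
    refine (MvPolynomial.totalDegree_mul _ _).trans ?_
    rw [MvPolynomial.totalDegree_C, MvPolynomial.totalDegree_X]
  · have ht : ∀ i, |x.ofLp i / R| ≤ 1 := by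
      intro i
      rw [abs_div, abs_of_pos hR, div_le_one hR]
      exact hx i
    set W : (Fin k → Fin N) → ℝ := fun m => ∏ i, (w (m i)).eval (x.ofLp i / R) with hW
    have hW0 : ∀ m, 0 ≤ W m := fun m => Finset.prod_nonneg fun i _ => hpos _ _ (ht i)
    have hW1 : ∑ m, W m = 1 := by
      rw [hW, hprod fun i j => (w j).eval (x.ofLp i / R)]
      simp [hsum]
    -- The weights form a product probability on the nodes, so integrating out the other coordinates
    -- leaves the one-dimensional second moment.
    have hmarg : ∀ i, ∑ m, W m * (c (m i) - x.ofLp i / R) ^ 2 ≤ 20 / (n : ℝ) ^ 2 := by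
      intro i
      refine le_trans (le_of_eq ?_) (hmom (x.ofLp i / R) (ht i))
      have h1 : ∀ m : Fin k → Fin N, W m * (c (m i) - x.ofLp i / R) ^ 2 =
          ∏ i', ((w (m i')).eval (x.ofLp i' / R) *
            if i' = i then (c (m i') - x.ofLp i' / R) ^ 2 else 1) := by
        intro m
        rw [Finset.prod_mul_distrib, Finset.prod_ite_eq' Finset.univ i
          fun i' => (c (m i') - x.ofLp i' / R) ^ 2, if_pos (Finset.mem_univ _)]
      simp_rw [h1]
      rw [hprod fun i' j => (w j).eval (x.ofLp i' / R) *
            if i' = i then (c j - x.ofLp i' / R) ^ 2 else 1]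
      rw [Finset.prod_eq_single i]
      · simp
      · intro i' _ hi'
        simp [hi', hsum]
      · simp
    have hsq : ∑ m, W m * ‖node m - x‖ ^ 2 ≤ R ^ 2 * (k * (20 / (n : ℝ) ^ 2)) := by
      have h1 : ∀ m, ‖node m - x‖ ^ 2 = R ^ 2 * ∑ i, (c (m i) - x.ofLp i / R) ^ 2 := by
        intro m
        rw [EuclideanSpace.real_norm_sq_eq, Finset.mul_sum]
        refine Finset.sum_congr rfl fun i _ => ?_
        simp only [node, PiLp.sub_apply]
        field_simp
      calc ∑ m, W m * ‖node m - x‖ ^ 2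
          = R ^ 2 * ∑ i, ∑ m, W m * (c (m i) - x.ofLp i / R) ^ 2 := by
            rw [Finset.sum_comm, Finset.mul_sum]
            refine Finset.sum_congr rfl fun m _ => ?_
            rw [h1, Finset.mul_sum, Finset.mul_sum, Finset.mul_sum]
            refine Finset.sum_congr rfl fun i _ => ?_
            ring
        _ ≤ R ^ 2 * ∑ i : Fin k, 20 / (n : ℝ) ^ 2 := by
            gcongr with i
            exact hmarg i
        _ = _ := by simp
    have hdiff : MvPolynomial.eval x.ofLp P - Φ x = ∑ m, W m * (Φ (node m) - Φ x) := by
      simp_rw [mul_sub]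
      rw [Finset.sum_sub_distrib, ← Finset.sum_mul, hW1, one_mul, heval]
      congr 1
      exact Finset.sum_congr rfl fun m _ => mul_comm _ _
    -- Cauchy–Schwarz passes from the second to the first moment; the constant 5 comes from `20 ≤
    -- 25`.
    have hfirst : ∑ m, W m * ‖node m - x‖ ≤ 5 * R * √k / n := by
      refine abs_le_of_sq_le_sq' ?_ (by positivity) |>.2
      calc (∑ m, W m * ‖node m - x‖) ^ 2 ≤ (∑ m, W m) * ∑ m, W m * ‖node m - x‖ ^ 2 := by
            refine Finset.sum_sq_le_sum_mul_sum_of_sq_le_mul _ (fun m _ => hW0 m)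
              (fun m _ => mul_nonneg (hW0 m) (sq_nonneg _)) fun m _ => le_of_eq ?_
            ring
        _ ≤ 1 * (R ^ 2 * (k * (20 / (n : ℝ) ^ 2))) := by rw [hW1]; gcongr
        _ ≤ (5 * R * √k / n) ^ 2 := by
            rw [div_pow, mul_pow, mul_pow, Real.sq_sqrt (Nat.cast_nonneg k), one_mul,
              mul_div_assoc', mul_div_assoc']
            refine div_le_div_of_nonneg_right ?_ (by positivity)
            have : 0 ≤ R ^ 2 * k := by positivity
            linarith
    rw [hdiff]
    calc _ ≤ ∑ m, |W m * (Φ (node m) - Φ x)| := Finset.abs_sum_le_sum_abs _ _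
      _ ≤ ∑ m, L * (W m * ‖node m - x‖) := by
          refine Finset.sum_le_sum fun m _ => ?_
          rw [abs_mul, abs_of_nonneg (hW0 m)]
          calc _ ≤ W m * (L * ‖node m - x‖) := mul_le_mul_of_nonneg_left (hLip _ _) (hW0 m)
            _ = _ := by ring
      _ = L * ∑ m, W m * ‖node m - x‖ := by rw [Finset.mul_sum]
      _ ≤ L * (5 * R * √k / n) := by gcongr
      _ = _ := by ring
  · rw [heval]
    calc _ ≤ ∑ m, |Φ (node m) * ∏ i, (w (m i)).eval (x.ofLp i / R)| :=
          Finset.abs_sum_le_sum_abs _ _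
      _ ≤ ∑ m : Fin k → Fin N, ∏ i, |(w (m i)).eval (x.ofLp i / R)| := by
          refine Finset.sum_le_sum fun m _ => ?_
          rw [abs_mul, Finset.abs_prod]
          exact mul_le_of_le_one_left (Finset.prod_nonneg fun i _ => abs_nonneg _) (hΦ _)
      _ = ∏ i, ∑ j, |(w j).eval (x.ofLp i / R)| := hprod fun i j => |(w j).eval (x.ofLp i / R)|
      _ ≤ ∏ i : Fin k, (n * (1 + 2 * (‖x‖ / R)) ^ n) := by
          refine Finset.prod_le_prod (fun i _ => Finset.sum_nonneg fun j _ => abs_nonneg _)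
            fun i _ => (habs _).trans ?_
          rw [abs_div, abs_of_pos hR]
          have : |x.ofLp i| ≤ ‖x‖ := by simpa using PiLp.norm_apply_le x i
          gcongr
      _ = _ := by simp

/-- The least Lipschitz majorant of a bounded function, with slope `2/ρ`. -/
theorem exists_lipschitz_majorant {E : Type*} [NormedAddCommGroup E] {f : E → ℝ}
    (hf : ∀ x, f x = -1 ∨ f x = 1) {ρ : ℝ} (hρ : 0 < ρ) :
    ∃ Φ : E → ℝ, (∀ x y, |Φ x - Φ y| ≤ 2 / ρ * ‖x - y‖) ∧ (∀ x, |Φ x| ≤ 1) ∧ (∀ x, f x ≤ Φ x) ∧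
      ∀ x, (∀ z, ‖z - x‖ ≤ ρ → f z = f x) → Φ x = f x := by
  have hf1 : ∀ z, f z ≤ 1 := fun z => by rcases hf z with h | h <;> rw [h]; norm_num
  have hfm1 : ∀ z, -1 ≤ f z := fun z => by rcases hf z with h | h <;> rw [h]; norm_num
  have hL : 0 ≤ 2 / ρ := by positivity
  have hle : ∀ x z, f z - 2 / ρ * ‖z - x‖ ≤ 1 := fun x z => by
    have := mul_nonneg hL (norm_nonneg (z - x))
    linarith [hf1 z]
  have hbdd : ∀ x, BddAbove (Set.range fun z => f z - 2 / ρ * ‖z - x‖) := fun x =>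
    ⟨1, by rintro _ ⟨z, rfl⟩; exact hle x z⟩
  have hge : ∀ x, f x ≤ ⨆ z, f z - 2 / ρ * ‖z - x‖ := fun x => by
    simpa using le_ciSup (hbdd x) x
  have hone : ∀ x y, (⨆ z, f z - 2 / ρ * ‖z - x‖) ≤
      (⨆ z, f z - 2 / ρ * ‖z - y‖) + 2 / ρ * ‖x - y‖ := by
    intro x y
    refine ciSup_le fun z => ?_
    have h1 := le_ciSup (hbdd y) z
    have h2 : ‖z - y‖ ≤ ‖z - x‖ + ‖x - y‖ := norm_sub_le_norm_sub_add_norm_sub z x y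
    have h3 := mul_le_mul_of_nonneg_left h2 hL
    linarith
  refine ⟨fun x => ⨆ z, f z - 2 / ρ * ‖z - x‖, fun x y => ?_, fun x => ?_, hge, fun x hx => ?_⟩
  · rw [abs_le]
    have h1 := hone x y
    have h2 := hone y x
    rw [norm_sub_rev] at h2
    constructor <;> linarith
  · exact abs_le.2 ⟨(hfm1 x).trans (hge x), ciSup_le (hle x)⟩
  · refine le_antisymm (ciSup_le fun z => ?_) (hge x)
    by_cases hz : ‖z - x‖ ≤ ρ
    · rw [hx z hz]
      have := mul_nonneg hL (norm_nonneg (z - x))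
      linarith
    -- Beyond distance `ρ` the penalty is at least 2, the full oscillation of `f`, so distant points
    -- cannot raise the supremum above `f x`.
    · have h2 : 2 ≤ 2 / ρ * ‖z - x‖ := by
        rw [div_mul_eq_mul_div, le_div_iff₀ hρ]
        linarith
      linarith [hf1 z, hfm1 x]

end Approximation

/-! ### Gaussian moments of radial monomials -/

section Moments

variable {k : ℕ}

local notation "𝔼" k => EuclideanSpace ℝ (Fin k)

theorem lintegral_exp_sq_div_four_gaussianReal_le :
    ∫⁻ t, ENNReal.ofReal (Real.exp (t ^ 2 / 4)) ∂(gaussianReal 0 1) ≤ 2 := by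
  rw [gaussianReal_of_var_ne_zero _ one_ne_zero,
    lintegral_withDensity_eq_lintegral_mul _ (measurable_gaussianPDF 0 1) (by fun_prop)]
  have h : ∀ t : ℝ, (gaussianPDF 0 1 * fun t => ENNReal.ofReal (Real.exp (t ^ 2 / 4))) t =
      ENNReal.ofReal ((√(2 * Real.pi))⁻¹ * Real.exp (-(1 / 4) * t ^ 2)) := by
    intro t
    rw [Pi.mul_apply, gaussianPDF_def, ← ENNReal.ofReal_mul (gaussianPDFReal_nonneg _ _ _),
      gaussianPDFReal_def, mul_assoc, ← Real.exp_add]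
    congr 3
    · simp
    · simp
      ring
  simp_rw [h]
  rw [← ofReal_integral_eq_lintegral_ofReal
    ((integrable_exp_neg_mul_sq (by norm_num)).const_mul _)
    (Filter.Eventually.of_forall fun t => by positivity), integral_const_mul, integral_gaussian]
  rw [show (2 : ℝ≥0∞) = ENNReal.ofReal 2 by simp]
  apply ENNReal.ofReal_le_ofReal
  have hpi := Real.pi_pos
  rw [inv_mul_le_iff₀ (by positivity)]
  apply Real.sqrt_le_iff.2
  refine ⟨by positivity, ?_⟩
  rw [mul_pow, Real.sq_sqrt (by positivity)]
  rw [div_div_eq_mul_div, div_one]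
  linarith

theorem lintegral_exp_norm_sq_div_four_stdGaussian_le :
    ∫⁻ x, ENNReal.ofReal (Real.exp (‖x‖ ^ 2 / 4)) ∂(stdGaussian (𝔼 k)) ≤ 2 ^ k := by
  have hint : Integrable (fun t : ℝ => Real.exp (t ^ 2 / 4)) (gaussianReal 0 1) := by
    refine ⟨by fun_prop, ?_⟩
    rw [hasFiniteIntegral_iff_ofReal (Filter.Eventually.of_forall fun t => (Real.exp_pos _).le)]
    exact lintegral_exp_sq_div_four_gaussianReal_le.trans_lt (by simp)
  have hval : ∫ t, Real.exp (t ^ 2 / 4) ∂(gaussianReal 0 1) ≤ 2 := by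
    rw [integral_eq_lintegral_of_nonneg_ae
      (Filter.Eventually.of_forall fun t => (Real.exp_pos _).le) (by fun_prop)]
    exact ENNReal.toReal_le_of_le_ofReal (by norm_num)
      (by simpa using lintegral_exp_sq_div_four_gaussianReal_le)
  rw [← map_pi_eq_stdGaussian, lintegral_map (by fun_prop) (by fun_prop)]
  have h : ∀ x : Fin k → ℝ, Real.exp (‖WithLp.toLp 2 x‖ ^ 2 / 4) =
      ∏ i, Real.exp (x i ^ 2 / 4) := by
    intro x
    rw [EuclideanSpace.real_norm_sq_eq, ← Real.exp_sum, Finset.sum_div]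
  simp_rw [h]
  rw [← ofReal_integral_eq_lintegral_ofReal
    (Integrable.fintype_prod (f := fun _ : Fin k => fun t : ℝ => Real.exp (t ^ 2 / 4))
      fun _ => hint)
    (Filter.Eventually.of_forall fun x => Finset.prod_nonneg fun i _ => (Real.exp_pos _).le),
    integral_fintype_prod_eq_prod fun _ : Fin k => fun t : ℝ => Real.exp (t ^ 2 / 4)]
  rw [Finset.prod_const, Finset.card_univ, Fintype.card_fin]
  calc _ ≤ ENNReal.ofReal (2 ^ k) := by
        apply ENNReal.ofReal_le_ofReal
        have : 0 ≤ ∫ t, Real.exp (t ^ 2 / 4) ∂(gaussianReal 0 1) :=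
          integral_nonneg fun t => (Real.exp_pos _).le
        gcongr
    _ = 2 ^ k := by
        rw [ENNReal.ofReal_pow (by norm_num)]
        simp

/-- With `u = ‖x‖²/4`, the inequality `y ≤ e^y` at `y = u/(Ms)` gives `(u/(Ms))^(Ms) ≤ e^u`, and
`e^u` has Gaussian integral at most `2^k`. -/
theorem eLpNorm_norm_sq_pow_stdGaussian_le {s b : ℝ} (hs : 1 ≤ s) (hb : 0 ≤ b) {M : ℕ}
    (hM : 0 < M) :
    eLpNorm (fun x : 𝔼 k => (b * ‖x‖ ^ 2) ^ M) (ENNReal.ofReal s) (stdGaussian (𝔼 k)) ≤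
      ENNReal.ofReal ((4 * b * M * s) ^ M * 2 ^ k) := by
  have hs0 : 0 < s := by linarith
  have hMs : 0 < M * s := by positivity
  rw [eLpNorm_eq_lintegral_rpow_enorm_toReal (by simpa using hs0) (by simp),
    ENNReal.toReal_ofReal hs0.le]
  have hpt : ∀ x : 𝔼 k, ‖(b * ‖x‖ ^ 2) ^ M‖ₑ ^ s ≤
      ENNReal.ofReal (((4 * b * M * s) ^ M) ^ s) * ENNReal.ofReal (Real.exp (‖x‖ ^ 2 / 4)) := by
    intro x
    rw [Real.enorm_eq_ofReal (by positivity), ENNReal.ofReal_rpow_of_nonneg (by positivity) hs0.le,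
      ← ENNReal.ofReal_mul (by positivity)]
    apply ENNReal.ofReal_le_ofReal
    set u := ‖x‖ ^ 2 / 4 with hu
    have hu0 : 0 ≤ u := by positivity
    have hb' : b * ‖x‖ ^ 2 = (4 * b * M * s) * (u / (M * s)) := by
      rw [hu]; field_simp
    rw [hb', mul_pow, Real.mul_rpow (by positivity) (by positivity)]
    gcongr
    have h1 : u / (M * s) ≤ Real.exp (u / (M * s)) := by
      linarith [Real.add_one_le_exp (u / (M * s))]
    calc ((u / (M * s)) ^ M) ^ s ≤ ((Real.exp (u / (M * s))) ^ M) ^ s := by gcongr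
      _ = Real.exp u := by
        rw [← Real.exp_nat_mul, ← Real.exp_mul]
        congr 1
        field_simp
  calc _ ≤ (∫⁻ x, ENNReal.ofReal (((4 * b * M * s) ^ M) ^ s) *
          ENNReal.ofReal (Real.exp (‖x‖ ^ 2 / 4)) ∂(stdGaussian (𝔼 k))) ^ (1 / s) := by
        gcongr with x
        exact hpt x
    _ ≤ (ENNReal.ofReal (((4 * b * M * s) ^ M) ^ s) * 2 ^ k) ^ (1 / s) := by
        gcongr
        rw [lintegral_const_mul _ (by fun_prop)]
        gcongr
        exact lintegral_exp_norm_sq_div_four_stdGaussian_le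
    _ = ENNReal.ofReal ((4 * b * M * s) ^ M) * (2 ^ k) ^ (1 / s) := by
        rw [ENNReal.mul_rpow_of_nonneg _ _ (by positivity),
          ENNReal.ofReal_rpow_of_nonneg (by positivity) (by positivity), ← Real.rpow_mul
          (by positivity), mul_one_div_cancel hs0.ne', Real.rpow_one]
    _ ≤ ENNReal.ofReal ((4 * b * M * s) ^ M) * 2 ^ k := by
        gcongr
        calc ((2 : ℝ≥0∞) ^ k) ^ (1 / s) ≤ (2 ^ k) ^ (1 : ℝ) := by
              apply ENNReal.rpow_le_rpow_of_exponent_le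
              · exact one_le_pow₀ (by norm_num)
              · rw [div_le_one hs0]; exact hs
          _ = 2 ^ k := ENNReal.rpow_one _
    _ = _ := by
        rw [ENNReal.ofReal_mul (by positivity)]
        congr 1
        rw [ENNReal.ofReal_pow (by norm_num)]
        simp

end Moments

/-! ### Sandwiching polynomials in `ℝ^k` -/

section Sandwich

variable {k : ℕ}

local notation "𝔼" k => EuclideanSpace ℝ (Fin k)

/-- The polynomial `A (b |x|²) ^ M`. -/
noncomputable def radialPoly (k : ℕ) (A b : ℝ) (M : ℕ) : MvPolynomial (Fin k) ℝ :=
  MvPolynomial.C A * (MvPolynomial.C b * ∑ i, MvPolynomial.X i ^ 2) ^ M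

theorem eval_radialPoly (A b : ℝ) (M : ℕ) (x : 𝔼 k) :
    MvPolynomial.eval x.ofLp (radialPoly k A b M) = A * (b * ‖x‖ ^ 2) ^ M := by
  simp [radialPoly, EuclideanSpace.real_norm_sq_eq]

theorem totalDegree_radialPoly_le (A b : ℝ) (M : ℕ) :
    (radialPoly k A b M).totalDegree ≤ 2 * M := by
  refine (MvPolynomial.totalDegree_mul _ _).trans ?_
  rw [MvPolynomial.totalDegree_C, zero_add]
  refine (MvPolynomial.totalDegree_pow _ _).trans ?_
  rw [mul_comm]
  refine Nat.mul_le_mul_right _ ((MvPolynomial.totalDegree_mul _ _).trans ?_)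
  rw [MvPolynomial.totalDegree_C, zero_add]
  exact MvPolynomial.totalDegree_finsetSum_le fun i _ => by rw [MvPolynomial.totalDegree_X_pow]

/-- One-sided polynomial approximation of a Lipschitz function on the whole space. -/
theorem exists_upper_mvPolynomial {n : ℕ} (hn : 2 ≤ n) {Φ : (𝔼 k) → ℝ} {L R : ℝ}
    (hL : 0 ≤ L) (hR : 0 < R) (hLip : ∀ x y, |Φ x - Φ y| ≤ L * ‖x - y‖) (hΦ : ∀ x, |Φ x| ≤ 1) :
    ∃ P : MvPolynomial (Fin k) ℝ, P.totalDegree ≤ 2 * (k * n) ∧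
      ∀ x : 𝔼 k, Φ x ≤ MvPolynomial.eval x.ofLp P ∧
        MvPolynomial.eval x.ofLp P ≤ Φ x + 2 * (5 * L * R * √k / n) +
          2 * (2 * (n : ℝ) ^ k * (9 / R ^ 2 * ‖x‖ ^ 2) ^ (k * n)) := by
  obtain ⟨P, hdeg, hcube, hgrow⟩ := exists_mvPolynomial_approx hn hL hR hLip hΦ
  have hn1 : (1 : ℝ) ≤ n := by exact_mod_cast (by omega : 1 ≤ n)
  set e := 5 * L * R * √k / n with he
  have he0 : 0 ≤ e := by positivity
  refine ⟨P + MvPolynomial.C e + radialPoly k (2 * (n : ℝ) ^ k) (9 / R ^ 2) (k * n), ?_,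
    fun x => ?_⟩
  · refine (MvPolynomial.totalDegree_add _ _).trans (max_le
      ((MvPolynomial.totalDegree_add _ _).trans (max_le ?_ ?_)) (totalDegree_radialPoly_le _ _ _))
    · omega
    · rw [MvPolynomial.totalDegree_C]; exact zero_le
  · rw [map_add, map_add, MvPolynomial.eval_C, eval_radialPoly]
    set B := (n : ℝ) ^ k * (9 / R ^ 2 * ‖x‖ ^ 2) ^ (k * n) with hB
    have hB0 : 0 ≤ B := by positivity
    rw [show 2 * (n : ℝ) ^ k * (9 / R ^ 2 * ‖x‖ ^ 2) ^ (k * n) = 2 * B by rw [hB]; ring]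
    by_cases hx : ∀ i, |x.ofLp i| ≤ R
    · have := abs_le.1 (hcube x hx)
      constructor <;> linarith
    · push Not at hx
      obtain ⟨i, hi⟩ := hx
      have hxR : R ≤ ‖x‖ := hi.le.trans (by simpa using PiLp.norm_apply_le x i)
      have h1 : 1 ≤ ‖x‖ / R := (one_le_div hR).2 hxR
      -- Outside the cube `‖x‖/R ≥ 1`, so the growth base `1 + 2‖x‖/R` is at most `3‖x‖/R`. The
      -- square makes it polynomial in `x`, and the resulting bound `B ≥ 1` dominates both `P` and
      -- `Φ`.
      have h9 : 9 / R ^ 2 * ‖x‖ ^ 2 = (3 * (‖x‖ / R)) ^ 2 := by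
        rw [mul_pow, div_pow]; ring
      have hb1 : 1 ≤ B := by
        rw [hB, h9]
        exact one_le_mul_of_one_le_of_one_le (one_le_pow₀ hn1)
          (one_le_pow₀ (one_le_pow₀ (by linarith)))
      have hPB : |MvPolynomial.eval x.ofLp P| ≤ B := by
        refine (hgrow x).trans ?_
        rw [mul_pow, hB, h9, ← pow_mul, mul_comm n k]
        gcongr
        nlinarith
      have hP := abs_le.1 hPB
      have hφ := abs_le.1 (hΦ x)
      constructor <;> linarith

/-- Minkowski with an uneven budget: the exceptional set uses `ε - ε/(2s)`, and the uniform error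
and the tail use `ε/(4s)` each. Halving `(ε/2)^s` already frees the amount `ε/(2s)`, so no loss
exponential in `s` occurs. -/
theorem eLpNorm_sandwich_le {G : Set (𝔼 k)} (hG : MeasurableSet G) {ε s e A b : ℝ} (hε : 0 < ε)
    (hs : 1 ≤ s) (hμG : stdGaussian (𝔼 k) G ≤ ENNReal.ofReal ((ε / 2) ^ s / 2)) (he : 0 ≤ e)
    (hes : e ≤ ε / (4 * s)) (hA : 0 ≤ A) (hb : 0 ≤ b) {M : ℕ} (hM : 0 < M)
    (hAM : A * ((4 * b * M * s) ^ M * 2 ^ k) ≤ ε / (4 * s)) {D : (𝔼 k) → ℝ}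
    (hD : ∀ x, ‖D x‖ ≤ G.indicator (fun _ => (2 : ℝ)) x + (e + A * (b * ‖x‖ ^ 2) ^ M)) :
    eLpNorm D (ENNReal.ofReal s) (stdGaussian (𝔼 k)) ≤ ENNReal.ofReal ε := by
  have hs0 : 0 < s := by linarith
  have hp : 1 ≤ ENNReal.ofReal s := by simpa using hs
  have hp0 : ENNReal.ofReal s ≠ 0 := by simpa using hs0
  have hhalf : 1 / (2 * s) ≤ 1 / 2 := one_div_le_one_div_of_le (by norm_num) (by linarith)
  have h1 : eLpNorm (G.indicator fun _ => (2 : ℝ)) (ENNReal.ofReal s) (stdGaussian (𝔼 k)) ≤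
      ENNReal.ofReal (ε - ε / (2 * s)) := by
    rw [eLpNorm_indicator_const hG hp0 (by simp), ENNReal.toReal_ofReal hs0.le]
    -- Bernoulli's inequality, in effect `2^(-1/s) ≤ 1 - 1/(2s)`.
    have hbern : 1 / 2 ≤ (1 - 1 / (2 * s)) ^ s := by
      have := one_add_mul_self_le_rpow_one_add (s := -(1 / (2 * s))) (by linarith) hs
      rw [← sub_eq_add_neg] at this
      refine le_trans (le_of_eq ?_) this
      field_simp
      norm_num
    have hle : stdGaussian (𝔼 k) G ≤ ENNReal.ofReal ((ε / 2 * (1 - 1 / (2 * s))) ^ s) := by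
      refine hμG.trans (ENNReal.ofReal_le_ofReal ?_)
      rw [Real.mul_rpow (by positivity) (by linarith)]
      have : 0 ≤ (ε / 2) ^ s := by positivity
      nlinarith
    have hnn : 0 ≤ ε / 2 * (1 - 1 / (2 * s)) := mul_nonneg (by positivity) (by linarith)
    calc _ ≤ ‖(2 : ℝ)‖ₑ * ENNReal.ofReal ((ε / 2 * (1 - 1 / (2 * s))) ^ s) ^ (1 / s) := by gcongr
      _ = ENNReal.ofReal 2 * ENNReal.ofReal (ε / 2 * (1 - 1 / (2 * s))) := by
          rw [ENNReal.ofReal_rpow_of_nonneg (by positivity) (by positivity),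
            ← Real.rpow_mul hnn, mul_one_div_cancel hs0.ne', Real.rpow_one,
            Real.enorm_eq_ofReal (by norm_num)]
      _ = _ := by
          rw [← ENNReal.ofReal_mul (by norm_num)]
          congr 1
          ring
  have h2 : eLpNorm (fun _ : 𝔼 k => e) (ENNReal.ofReal s) (stdGaussian (𝔼 k)) ≤
      ENNReal.ofReal (ε / (4 * s)) := by
    rw [eLpNorm_const e hp0 (IsProbabilityMeasure.ne_zero _), measure_univ, ENNReal.one_rpow,
      mul_one, Real.enorm_eq_ofReal he]
    exact ENNReal.ofReal_le_ofReal hes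
  have h3 : eLpNorm (fun x : 𝔼 k => A * (b * ‖x‖ ^ 2) ^ M) (ENNReal.ofReal s)
      (stdGaussian (𝔼 k)) ≤ ENNReal.ofReal (ε / (4 * s)) := by
    have := eLpNorm_const_smul A (fun x : 𝔼 k => (b * ‖x‖ ^ 2) ^ M) (ENNReal.ofReal s)
      (stdGaussian (𝔼 k))
    calc _ = ‖A‖ₑ * _ := this
      _ ≤ ENNReal.ofReal A * ENNReal.ofReal ((4 * b * M * s) ^ M * 2 ^ k) := by
          rw [Real.enorm_eq_ofReal hA]
          gcongr
          exact eLpNorm_norm_sq_pow_stdGaussian_le hs hb hM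
      _ = ENNReal.ofReal (A * ((4 * b * M * s) ^ M * 2 ^ k)) := (ENNReal.ofReal_mul hA).symm
      _ ≤ _ := ENNReal.ofReal_le_ofReal hAM
  calc _ ≤ eLpNorm (G.indicator (fun _ => (2 : ℝ)) + ((fun _ : 𝔼 k => e) +
          fun x : 𝔼 k => A * (b * ‖x‖ ^ 2) ^ M)) (ENNReal.ofReal s) (stdGaussian (𝔼 k)) :=
        eLpNorm_mono_real hD
    _ ≤ _ := eLpNorm_add_le ((measurable_const.indicator hG).aestronglyMeasurable)
        (by fun_prop) hp
    _ ≤ _ := add_le_add_right (eLpNorm_add_le (by fun_prop) (by fun_prop) hp) _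
    _ ≤ ENNReal.ofReal (ε - ε / (2 * s)) +
        (ENNReal.ofReal (ε / (4 * s)) + ENNReal.ofReal (ε / (4 * s))) := by gcongr
    _ = ENNReal.ofReal ε := by
        rw [← ENNReal.ofReal_add (by positivity) (by positivity), ← ENNReal.ofReal_add]
        · congr 1
          field_simp
          ring
        · have : ε / (2 * s) = ε * (1 / (2 * s)) := by ring
          nlinarith
        · positivity

/-- The left side is `8 (2n/4^n)^k`; the base is at most 1, so a single power suffices, and `n ≤
2^n` bounds it by `2/n`. -/
theorem tail_coefficient_le {n : ℕ} {ε s : ℝ} (hε : 0 < ε) (hs : 1 ≤ s) (hk : 1 ≤ k)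
    (hn : 64 * s / ε ≤ n) :
    4 * (2 * (n : ℝ) ^ k) * ((1 / 4) ^ (k * n) * 2 ^ k) ≤ ε / (4 * s) := by
  have hn0 : (0 : ℝ) < n := lt_of_lt_of_le (by positivity) hn
  have h2 : (n : ℝ) ≤ 2 ^ n := by exact_mod_cast Nat.lt_two_pow_self.le
  have h4 : (4 : ℝ) ^ n = 2 ^ n * 2 ^ n := by rw [← mul_pow]; norm_num
  have hx1 : 2 * (n : ℝ) / 4 ^ n ≤ 2 / n := by
    rw [div_le_div_iff₀ (by positivity) hn0, h4]
    nlinarith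
  have h64 : 64 * s ≤ n * ε := (div_le_iff₀ hε).1 hn
  have hfin : 2 / (n : ℝ) ≤ ε / (32 * s) := by
    rw [div_le_div_iff₀ hn0 (by positivity)]
    linarith
  have hone : 2 * (n : ℝ) / 4 ^ n ≤ 1 := by
    rw [div_le_one (by positivity), h4]
    have : 2 ≤ (2 : ℝ) ^ n := by
      have hn1 : 1 ≤ n := by exact_mod_cast hn0
      calc (2 : ℝ) = 2 ^ 1 := by norm_num
        _ ≤ 2 ^ n := pow_le_pow_right₀ (by norm_num) hn1
    nlinarith
  calc 4 * (2 * (n : ℝ) ^ k) * ((1 / 4) ^ (k * n) * 2 ^ k) = 8 * (2 * (n : ℝ) / 4 ^ n) ^ k := by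
        rw [mul_comm k n, pow_mul, div_pow _ _ k, mul_pow 2 (n : ℝ) k, one_div, inv_pow, inv_pow]
        ring
    _ ≤ 8 * (2 * (n : ℝ) / 4 ^ n) := by
        gcongr
        exact pow_le_of_le_one (by positivity) hone (by omega)
    _ ≤ 8 * (ε / (32 * s)) := by
        exact mul_le_mul_of_nonneg_left (hx1.trans hfin) (by norm_num)
    _ = ε / (4 * s) := by field_simp; norm_num

theorem IsPTF.hasSandwichingPolynomials {q : ℕ} (hk : 1 ≤ k) (hq : 1 ≤ q) {f : (𝔼 k) → ℝ}
    (hc : IsConcept f) (hf : IsPTF q f) {ε s : ℝ} (hε : 0 < ε) (hε1 : ε < 1) (hs : 1 ≤ s) {n : ℕ}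
    (hn : (30720 * ((q : ℝ) ^ 3 * k ^ 2 * (2 / ε) ^ (s + 1))) ^ 2 * s ^ 3 ≤ n) :
    HasSandwichingPolynomials (stdGaussian (𝔼 k)) ε s f (2 * (k * n)) := by
  have hs0 : 0 < s := by linarith
  have hk1 : (1 : ℝ) ≤ k := by exact_mod_cast hk
  have hq1 : (1 : ℝ) ≤ q := by exact_mod_cast hq
  set T := (2 / ε) ^ s with hT
  have h2ε : 2 ≤ 2 / ε := by rw [le_div_iff₀ hε]; linarith
  have hT1 : 1 ≤ T := Real.one_le_rpow (by linarith) hs0.le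
  have hT' : (2 / ε) ^ (s + 1) = T * (2 / ε) := by
    rw [Real.rpow_add (by positivity), Real.rpow_one]
  rw [hT'] at hn
  have hqk : 1 ≤ (q : ℝ) ^ 3 * k ^ 2 := one_le_mul_of_one_le_of_one_le (one_le_pow₀ hq1) (one_le_pow₀ hk1)
  have hbase : 2 / ε ≤ (q : ℝ) ^ 3 * k ^ 2 * (T * (2 / ε)) := by
    have : 1 ≤ (q : ℝ) ^ 3 * k ^ 2 * T := one_le_mul_of_one_le_of_one_le hqk hT1
    nlinarith
  have hs3 : s ≤ s ^ 3 := by nlinarith [sq_nonneg s, mul_nonneg hs0.le (sub_nonneg.2 hs)]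
  have hn64 : 64 * s / ε ≤ n := by
    refine le_trans ?_ hn
    calc 64 * s / ε = 32 * (2 / ε) * s := by ring
      _ ≤ (30720 * ((q : ℝ) ^ 3 * k ^ 2 * (T * (2 / ε)))) ^ 2 * s ^ 3 := by
          gcongr
          nlinarith
  have hn64' : (64 : ℝ) ≤ n := by
    refine le_trans ?_ hn64
    rw [le_div_iff₀ hε]
    nlinarith
  have hn2 : 2 ≤ n := by
    have : (2 : ℝ) ≤ n := by linarith
    exact_mod_cast this
  have hn0 : (0 : ℝ) < n := by linarith
  -- Chosen so that `16 q³ k ρ = (ε/2)^s / 2`, the measure allowed for the exceptional set.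
  set ρ := (32 * (q : ℝ) ^ 3 * k * T)⁻¹ with hρ
  have hρ0 : 0 < ρ := by positivity
  -- Chosen so that `4 b M s = 1/4` for `b = 9/R²` and `M = k n`, which makes the moment of the
  -- radial term decay like `4^(-kn)`.
  set R := 12 * √(k * n * s) with hR
  have hR0 : 0 < R := by positivity
  have hR2 : R ^ 2 = 144 * (k * n * s) := by
    rw [hR, mul_pow, Real.sq_sqrt (by positivity)]; norm_num
  obtain ⟨G, hG, hμG, hstable⟩ := hf.exists_stable_off_small_set hq hρ0
  obtain ⟨Φ, hΦL, hΦ1, hΦf, hΦG⟩ := exists_lipschitz_majorant hc hρ0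
  -- A majorant of `-f`, whose polynomial majorant is negated to give the lower polynomial.
  obtain ⟨Ψ, hΨL, hΨ1, hΨf, hΨG⟩ := exists_lipschitz_majorant (f := fun x => - f x)
    (fun x => (hc x).symm.imp (fun h => by simp [h]) (fun h => by simp [h])) hρ0
  obtain ⟨P, hPdeg, hP⟩ := exists_upper_mvPolynomial hn2 (by positivity) hR0 hΦL hΦ1
  obtain ⟨Q, hQdeg, hQ⟩ := exists_upper_mvPolynomial hn2 (by positivity) hR0 hΨL hΨ1
  set e := 5 * (2 / ρ) * R * √k / n with he
  have he0 : 0 ≤ e := by positivity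
  have hbound : e ≤ ε / (16 * s) := by
    have hsqrt : √(k * n * s) = √k * √n * √s := by
      rw [Real.sqrt_mul (by positivity), Real.sqrt_mul (by positivity)]
    have hkk : √(k : ℝ) * √k = k := Real.mul_self_sqrt (by positivity)
    have hnn : √(n : ℝ) * √n = n := Real.mul_self_sqrt (by positivity)
    have hss : √s * √s = s := Real.mul_self_sqrt hs0.le
    have hsn : 30720 * ((q : ℝ) ^ 3 * k ^ 2 * (T * (2 / ε))) * s * √s ≤ √n := by
      apply Real.le_sqrt_of_sq_le
      refine le_trans (le_of_eq ?_) hn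
      rw [mul_pow, mul_pow, Real.sq_sqrt hs0.le]
      ring
    have hsn0 : 0 < √(n : ℝ) := Real.sqrt_pos.2 hn0
    have he2 : e = 3840 * ((q : ℝ) ^ 3 * k ^ 2 * T) * √s / √n := by
      rw [he, hρ, hR, hsqrt, div_eq_div_iff hn0.ne' hsn0.ne']
      rw [div_inv_eq_mul]
      calc _ = 3840 * ((q : ℝ) ^ 3 * k * T) * √s * (√k * √k) * (√n * √n) := by ring
        _ = _ := by rw [hkk, hnn]; ring
    rw [he2, div_le_div_iff₀ hsn0 (by positivity)]
    calc 3840 * ((q : ℝ) ^ 3 * k ^ 2 * T) * √s * (16 * s)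
        = ε * (30720 * ((q : ℝ) ^ 3 * k ^ 2 * (T * (2 / ε))) * s * √s) := by field_simp; norm_num
      _ ≤ ε * √n := by gcongr
  set b := 9 / R ^ 2 with hb
  have hM : 0 < k * n := Nat.mul_pos (by omega) (by omega)
  have hbM : 4 * b * ((k * n : ℕ) : ℝ) * s = 1 / 4 := by
    rw [hb, hR2]
    push_cast
    field_simp
    norm_num
  refine ⟨P, -Q, hPdeg, by rwa [MvPolynomial.totalDegree_neg], fun x => ⟨?_, ?_⟩, ?_⟩
  · rw [map_neg]
    linarith [(hQ x).1, hΨf x]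
  · exact (hΦf x).trans (hP x).1
  -- The upper and lower polynomials each contribute `2e` and twice the radial term, hence the
  -- factors 4.
  · refine eLpNorm_sandwich_le hG hε hs ?_ (e := 4 * e) (by positivity) ?_
      (A := 4 * (2 * (n : ℝ) ^ k)) (b := b) (by positivity) (by positivity) hM ?_ fun x => ?_
    · refine hμG.trans_eq ?_
      congr 1
      rw [hρ, hT, ← inv_div, Real.inv_rpow (by positivity)]
      field_simp
      norm_num
    · calc 4 * e ≤ 4 * (ε / (16 * s)) := by gcongr
        _ = ε / (4 * s) := by field_simp; norm_num
    · rw [hbM]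
      exact tail_coefficient_le hε hs hk hn64
    -- Off `G` the two majorants equal `f` and `-f` and cancel; on `G` each is at most 1.
    · have hGx : Φ x + Ψ x ≤ G.indicator (fun _ => (2 : ℝ)) x := by
        by_cases hx : x ∈ G
        · rw [Set.indicator_of_mem hx]
          linarith [(abs_le.1 (hΦ1 x)).2, (abs_le.1 (hΨ1 x)).2]
        · rw [Set.indicator_of_notMem hx, hΦG x (hstable x hx),
            hΨG x fun z hz => by rw [hstable x hx z hz]]
          simp
      rw [map_neg, Real.norm_eq_abs, abs_of_nonneg (by linarith [(hP x).1, (hQ x).1, hΦf x, hΨf x])]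
      linarith [(hP x).2, (hQ x).2]

end Sandwich

/-! ### Passage between `ℝ^d` and `ℝ^k` -/

section Projection

variable {d k : ℕ}

local notation "𝔼" k => EuclideanSpace ℝ (Fin k)

theorem inner_toLp_mulVec (W : Matrix (Fin k) (Fin d) ℝ) (x : 𝔼 d) (t : 𝔼 k) :
    inner ℝ (WithLp.toLp 2 (W *ᵥ x.ofLp)) t = inner ℝ x (WithLp.toLp 2 (Wᵀ *ᵥ t.ofLp)) := by
  simp only [EuclideanSpace.inner_eq_star_dotProduct, star_trivial]
  rw [Matrix.mulVec_transpose, Matrix.dotProduct_mulVec]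

theorem continuous_toLp_mulVec (W : Matrix (Fin k) (Fin d) ℝ) :
    Continuous fun x : 𝔼 d => (WithLp.toLp 2 (W *ᵥ x.ofLp) : 𝔼 k) := by
  refine (PiLp.continuous_toLp 2 _).comp ?_
  exact Continuous.matrix_mulVec continuous_const (PiLp.continuous_ofLp 2 _)

/-- By duality the characteristic function at `t` is evaluated at `Wᵀ t`, and `W Wᵀ = 1` makes `Wᵀ`
an isometry. -/
theorem measurePreserving_toLp_mulVec {W : Matrix (Fin k) (Fin d) ℝ} (hW : W * Wᵀ = 1) :
    MeasurePreserving (fun x : 𝔼 d => (WithLp.toLp 2 (W *ᵥ x.ofLp) : 𝔼 k))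
      (stdGaussian (𝔼 d)) (stdGaussian (𝔼 k)) := by
  have hm := (continuous_toLp_mulVec W).measurable
  refine ⟨hm, ?_⟩
  have : IsProbabilityMeasure ((stdGaussian (𝔼 d)).map
      fun x : 𝔼 d => (WithLp.toLp 2 (W *ᵥ x.ofLp) : 𝔼 k)) :=
    Measure.isProbabilityMeasure_map hm.aemeasurable
  apply Measure.ext_of_charFun
  ext t
  rw [charFun_apply, integral_map hm.aemeasurable (by fun_prop)]
  simp_rw [inner_toLp_mulVec]
  rw [← charFun_apply, charFun_stdGaussian, charFun_stdGaussian]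
  have h : ‖(WithLp.toLp 2 (Wᵀ *ᵥ t.ofLp) : 𝔼 d)‖ ^ 2 = ‖t‖ ^ 2 := by
    rw [← real_inner_self_eq_norm_sq, ← real_inner_self_eq_norm_sq, ← inner_toLp_mulVec]
    simp only [Matrix.mulVec_mulVec, hW, Matrix.one_mulVec]
  have h' : ((‖(WithLp.toLp 2 (Wᵀ *ᵥ t.ofLp) : 𝔼 d)‖ : ℝ) : ℂ) ^ 2 = (‖t‖ : ℂ) ^ 2 := by
    exact_mod_cast h
  rw [h']

/-- The linear forms given by the rows of a matrix. -/
noncomputable def rowForm (W : Matrix (Fin k) (Fin d) ℝ) (i : Fin k) : MvPolynomial (Fin d) ℝ :=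
  ∑ j, MvPolynomial.C (W i j) * MvPolynomial.X j

theorem totalDegree_rowForm_le (W : Matrix (Fin k) (Fin d) ℝ) (i : Fin k) :
    (rowForm W i).totalDegree ≤ 1 := by
  refine MvPolynomial.totalDegree_finsetSum_le fun j _ => (MvPolynomial.totalDegree_mul _ _).trans ?_
  rw [MvPolynomial.totalDegree_C, MvPolynomial.totalDegree_X]

theorem eval_aeval_rowForm (W : Matrix (Fin k) (Fin d) ℝ) (P : MvPolynomial (Fin k) ℝ)
    (x : Fin d → ℝ) :
    MvPolynomial.eval x (MvPolynomial.aeval (rowForm W) P) = MvPolynomial.eval (W *ᵥ x) P := by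
  rw [eval_aeval_mvPolynomial]
  congr 2
  ext i
  simp [rowForm, Matrix.mulVec, dotProduct]

theorem IsPTF.comp_mulVec {q : ℕ} {f : (𝔼 d) → ℝ} (hf : IsPTF q f) (V : Matrix (Fin d) (Fin k) ℝ) :
    IsPTF q fun y : 𝔼 k => f (WithLp.toLp 2 (V *ᵥ y.ofLp)) := by
  obtain ⟨p, hdeg, hpos, hneg⟩ := hf
  refine ⟨MvPolynomial.aeval (rowForm V) p,
    (totalDegree_aeval_le_of_affine p _ (totalDegree_rowForm_le V)).trans hdeg,
    fun y hy => hpos _ ?_, fun y hy => hneg _ ?_⟩ <;>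
  rwa [eval_aeval_rowForm] at hy

theorem HasSandwichingPolynomials.comp_mulVec {F : (𝔼 k) → ℝ} {ε s : ℝ} {ℓ : ℕ}
    (hF : HasSandwichingPolynomials (stdGaussian (𝔼 k)) ε s F ℓ)
    {W : Matrix (Fin k) (Fin d) ℝ} (hW : W * Wᵀ = 1) :
    HasSandwichingPolynomials (stdGaussian (𝔼 d)) ε s
      (fun x => F (WithLp.toLp 2 (W *ᵥ x.ofLp))) ℓ := by
  obtain ⟨P, Q, hP, hQ, hPQ, hnorm⟩ := hF
  refine ⟨MvPolynomial.aeval (rowForm W) P, MvPolynomial.aeval (rowForm W) Q,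
    (totalDegree_aeval_le_of_affine P _ (totalDegree_rowForm_le W)).trans hP,
    (totalDegree_aeval_le_of_affine Q _ (totalDegree_rowForm_le W)).trans hQ, fun x => ?_, ?_⟩
  · rw [eval_aeval_rowForm, eval_aeval_rowForm]
    exact hPQ (WithLp.toLp 2 (W *ᵥ x.ofLp))
  · set g : (𝔼 k) → ℝ := fun y => MvPolynomial.eval y.ofLp P - MvPolynomial.eval y.ofLp Q with hg
    have hgm : Continuous g := (continuous_eval_ofLp P).sub (continuous_eval_ofLp Q)
    have hcomp : (fun x : 𝔼 d => MvPolynomial.eval x.ofLp (MvPolynomial.aeval (rowForm W) P) -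
        MvPolynomial.eval x.ofLp (MvPolynomial.aeval (rowForm W) Q)) =
        g ∘ fun x : 𝔼 d => (WithLp.toLp 2 (W *ᵥ x.ofLp) : 𝔼 k) := by
      ext x
      simp only [hg, Function.comp_apply, eval_aeval_rowForm]
    rw [hcomp, eLpNorm_comp_measurePreserving hgm.aestronglyMeasurable
      (measurePreserving_toLp_mulVec hW)]
    exact hnorm

theorem hasSandwichingPolynomials_const (μ : Measure (𝔼 d)) (ε s c : ℝ) :
    HasSandwichingPolynomials μ ε s (fun _ => c) 0 :=
  ⟨MvPolynomial.C c, MvPolynomial.C c, by simp, by simp, fun x => by simp, by simp⟩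

theorem IsPTF.eq_const_of_degree_zero {f : (𝔼 d) → ℝ} (hf : IsPTF 0 f) : ∃ c, f = fun _ => c := by
  obtain ⟨p, hdeg, hpos, hneg⟩ := hf
  rw [Nat.le_zero, MvPolynomial.totalDegree_eq_zero_iff_eq_C] at hdeg
  rcases lt_or_ge (p.coeff 0) 0 with h | h
  · refine ⟨-1, funext fun x => hneg x ?_⟩
    rw [hdeg]; simpa using h
  · refine ⟨1, funext fun x => hpos x ?_⟩
    rw [hdeg]; simpa using h

theorem HasIntrinsicDimension.eq_const_of_zero {f : (𝔼 d) → ℝ} (hf : HasIntrinsicDimension 0 f) :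
    ∃ c, f = fun _ => c := by
  obtain ⟨F, W, -, -, h⟩ := hf
  exact ⟨F 0, funext fun x => by rw [h, Subsingleton.elim (WithLp.toLp 2 (W *ᵥ x.ofLp)) 0]⟩

theorem hasSandwichingPolynomials_of_mem_ptfClass {q : ℕ} (hk : 1 ≤ k) (hq : 1 ≤ q)
    {f : (𝔼 d) → ℝ} (hf : f ∈ ptfClass d q k) {ε s : ℝ} (hε : 0 < ε) (hε1 : ε < 1) (hs : 1 ≤ s)
    {n : ℕ} (hn : (30720 * ((q : ℝ) ^ 3 * k ^ 2 * (2 / ε) ^ (s + 1))) ^ 2 * s ^ 3 ≤ n) :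
    HasSandwichingPolynomials (stdGaussian (𝔼 d)) ε s f (2 * (k * n)) := by
  obtain ⟨hptf, F, W, hF, hW, hfF⟩ := hf
  -- `Wᵀ` is a right inverse of `W`, so `F` is recovered from `f` and inherits its polynomial.
  have hFf : F = fun y : 𝔼 k => f (WithLp.toLp 2 (Wᵀ *ᵥ y.ofLp)) := by
    ext y
    rw [hfF]
    simp [Matrix.mulVec_mulVec, hW]
  have hFptf : IsPTF q F := by
    rw [hFf]
    exact hptf.comp_mulVec Wᵀ
  rw [show f = fun x => F (WithLp.toLp 2 (W *ᵥ x.ofLp)) from funext hfF]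
  exact (hFptf.hasSandwichingPolynomials hk hq hF hε hε1 hs hn).comp_mulVec hW

theorem classSandwichingDegree_le {μ : Measure (𝔼 d)} {ε s : ℝ} {𝓕 : Set ((𝔼 d) → ℝ)} {ℓ : ℕ}
    (h : ∀ f ∈ 𝓕, HasSandwichingPolynomials μ ε s f ℓ) :
    classSandwichingDegree μ ε s 𝓕 ≤ ℓ :=
  iSup₂_le fun f hf => iInf₂_le ℓ (h f hf)

end Projection

/-! ### Comparison with the stated complexity -/

theorem ptfComplexity_eq {q k : ℕ} {ε s : ℝ} (hε : 0 < ε) :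
    ptfComplexity q k ε s = (q : ℝ) ^ 3 * (k : ℝ) ^ 2 * (2 / ε) ^ (s + 1) * √k * s := by
  have h : (k : ℝ) ^ (5 / 2 : ℝ) = (k : ℝ) ^ 2 * √k := by
    rw [Real.sqrt_eq_rpow]
    rcases Nat.eq_zero_or_pos k with rfl | hk
    · rw [Nat.cast_zero, Real.zero_rpow (by norm_num), Real.zero_rpow (by norm_num), mul_zero]
    · rw [← Real.rpow_natCast, ← Real.rpow_add (by exact_mod_cast hk)]
      norm_num
  rw [ptfComplexity, h, ← inv_div ε 2, Real.inv_rpow (by positivity)]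
  ring

/-- Since `2/ε ≥ 2`, the complexity is at least `2^(s+1)`, and `log 2 ≥ 1/2`. This lets the
logarithm absorb a spare power of `s`. -/
theorem half_le_log_ptfComplexity {q k : ℕ} (hk : 1 ≤ k) (hq : 1 ≤ q) {ε s : ℝ} (hε : 0 < ε)
    (hε1 : ε < 1) (hs : 1 ≤ s) : (s + 1) / 2 ≤ Real.log (ptfComplexity q k ε s + 2) := by
  have hk1 : (1 : ℝ) ≤ k := by exact_mod_cast hk
  have hq1 : (1 : ℝ) ≤ q := by exact_mod_cast hq
  have h2ε : 2 ≤ 2 / ε := by rw [le_div_iff₀ hε]; linarith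
  have hX : (2 : ℝ) ^ (s + 1) ≤ ptfComplexity q k ε s + 2 := by
    rw [ptfComplexity_eq hε]
    have h1 : (2 : ℝ) ^ (s + 1) ≤ (2 / ε) ^ (s + 1) := by gcongr
    have h2 : 1 ≤ (q : ℝ) ^ 3 * (k : ℝ) ^ 2 :=
      one_le_mul_of_one_le_of_one_le (one_le_pow₀ hq1) (one_le_pow₀ hk1)
    have h3 : 1 ≤ √k * s := one_le_mul_of_one_le_of_one_le (Real.one_le_sqrt.2 hk1) hs
    have h4 : 0 ≤ (2 / ε) ^ (s + 1) := by positivity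
    calc (2 : ℝ) ^ (s + 1) ≤ 1 * (2 / ε) ^ (s + 1) * 1 := by linarith
      _ ≤ (q : ℝ) ^ 3 * (k : ℝ) ^ 2 * (2 / ε) ^ (s + 1) * (√k * s) := by gcongr
      _ ≤ _ := by linarith
  have hlog := Real.log_le_log (by positivity) hX
  rw [Real.log_rpow (by norm_num)] at hlog
  nlinarith [Real.log_two_gt_d9]

theorem theorem4p8 :
    ∃ (C : ℝ) (c : ℕ), 0 < C ∧ ∀ (d q k : ℕ) (ε s : ℝ), 0 < ε → ε < 1 → 1 ≤ s →
      (classSandwichingDegree (stdGaussian (EuclideanSpace ℝ (Fin d))) ε s (ptfClass d q k) : ℝ≥0∞)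
        ≤ ENNReal.ofReal
          ((C * ptfComplexity q k ε s * Real.log (ptfComplexity q k ε s + 2) ^ c) ^ 2) := by
  refine ⟨122880, 1, by norm_num, fun d q k ε s hε hε1 hs => ?_⟩
  -- For `q = 0` or `k = 0` the right-hand side is `0`, so degree `0` is required; it is available
  -- because `f` is then constant.
  rcases Nat.eq_zero_or_pos q with rfl | hq
  · have h := classSandwichingDegree_le (μ := stdGaussian (EuclideanSpace ℝ (Fin d)))
      (ε := ε) (s := s) (𝓕 := ptfClass d 0 k) (ℓ := 0) fun f hf => by
        obtain ⟨c, rfl⟩ := hf.1.eq_const_of_degree_zero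
        exact hasSandwichingPolynomials_const _ _ _ _
    rw [show classSandwichingDegree (stdGaussian (EuclideanSpace ℝ (Fin d))) ε s (ptfClass d 0 k) = 0
      from le_antisymm (by simpa using h) zero_le]
    simp
  rcases Nat.eq_zero_or_pos k with rfl | hk
  · have h := classSandwichingDegree_le (μ := stdGaussian (EuclideanSpace ℝ (Fin d)))
      (ε := ε) (s := s) (𝓕 := ptfClass d q 0) (ℓ := 0) fun f hf => by
        obtain ⟨c, rfl⟩ := hf.2.eq_const_of_zero
        exact hasSandwichingPolynomials_const _ _ _ _
    rw [show classSandwichingDegree (stdGaussian (EuclideanSpace ℝ (Fin d))) ε s (ptfClass d q 0) = 0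
      from le_antisymm (by simpa using h) zero_le]
    simp
  have hk1 : (1 : ℝ) ≤ k := by exact_mod_cast hk
  have hq1 : (1 : ℝ) ≤ q := by exact_mod_cast hq
  have hs0 : 0 < s := by linarith
  have h2ε : 1 ≤ 2 / ε := by rw [le_div_iff₀ hε]; linarith
  set Y := (q : ℝ) ^ 3 * k ^ 2 * (2 / ε) ^ (s + 1) with hY
  have hY1 : 1 ≤ Y := one_le_mul_of_one_le_of_one_le
    (one_le_mul_of_one_le_of_one_le (one_le_pow₀ hq1) (one_le_pow₀ hk1))
    (Real.one_le_rpow h2ε (by linarith))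
  set B := (30720 * Y) ^ 2 * s ^ 3 with hB
  have hB1 : 1 ≤ B := one_le_mul_of_one_le_of_one_le (one_le_pow₀ (by linarith)) (one_le_pow₀ hs)
  set n := ⌈B⌉₊ with hn
  have hBn : B ≤ n := Nat.le_ceil B
  have hnB : (n : ℝ) ≤ 2 * B := by
    have := Nat.ceil_lt_add_one (by linarith : 0 ≤ B)
    linarith
  have hdeg := classSandwichingDegree_le fun f (hf : f ∈ ptfClass d q k) =>
    hasSandwichingPolynomials_of_mem_ptfClass hk hq hf hε hε1 hs hBn
  have hX : ptfComplexity q k ε s = Y * √k * s := ptfComplexity_eq hε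
  have hlog := half_le_log_ptfComplexity hk hq hε hε1 hs
  set Λ := Real.log (ptfComplexity q k ε s + 2) with hΛ
  calc ((classSandwichingDegree (stdGaussian (EuclideanSpace ℝ (Fin d))) ε s (ptfClass d q k) : ℕ∞) :
        ℝ≥0∞) ≤ (((2 * (k * n) : ℕ) : ℕ∞) : ℝ≥0∞) := ENat.toENNReal_mono hdeg
    _ = ENNReal.ofReal ((2 * (k * n) : ℕ) : ℝ) := by
        rw [ENat.toENNReal_coe, ENNReal.ofReal_natCast]
    _ ≤ _ := by
        apply ENNReal.ofReal_le_ofReal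
        rw [hX, pow_one]
        push_cast
        have hsΛ : s ≤ (2 * Λ) ^ 2 := by nlinarith
        calc 2 * ((k : ℝ) * n) ≤ 2 * (k * (2 * B)) := by gcongr
          -- One factor `s` remains outside the square; replacing it by `(2Λ)²` doubles the constant
          -- to `122880` and accounts for the exponent `c = 1`.
          _ = (61440 * (Y * √k * s)) ^ 2 * s := by
              rw [hB, mul_pow 61440, mul_pow (Y * √k), mul_pow Y, Real.sq_sqrt (by positivity)]
              ring
          _ ≤ (61440 * (Y * √k * s)) ^ 2 * (2 * Λ) ^ 2 := by gcongr
          _ = _ := by ring
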